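/- Let $\mathfrak n$ be a Lie algebra over $\mathbb C$ which is socle, i.e. $\mathfrak n=\bigcup_{k}\mathfrak n_k$ for a chain $\mathfrak n_1\subseteq\mathfrak n_2\subseteq\cdots$ of finite-dimensional nilpotent ideals of $\mathfrak n$; fix such a chain. The symmetric algebra $\mathrm S(\mathfrak n)$ carries the Poisson bracket determined by $\{x,y\}=[x,y]$ for $x,y\in\mathfrak n$; an ideal $I\subseteq\mathrm S(\mathfrak n)$ is called Poisson if $\{\mathrm S(\mathfrak n),I\}\subseteq I$. For $\lambda\in\mathfrak n^*$ let $I_\lambda$ be the kernel of the evaluation homomorphism $\mathrm S(\mathfrak n)\to\mathbb C$, $f\mapsto f(\lambda)$, and let $I(\lambda)$ be the largest Poisson ideal of $\mathrm S(\mathfrak n)$ contained in $I_\lambda$. Let $N_l=\operatorname{Exp}\mathfrak n_l$ be the unipotent algebraic group with Lie algebra $\mathfrak n_l$. As $\mathfrak n_k$ is an ideal, for $l\ge k$ the group $N_l$ acts on $\mathfrak n_k^*$ by the coadjoint action; let $\rho_k^l\colon N_l\to\mathrm{GL}(\mathfrak n_k^*)$ be the corresponding homomorphism, so that $\rho_k^l(\exp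 x)=\exp(\operatorname{ad}^*x)$ with $((\operatorname{ad}^*x)f)(y)=-f([x,y])$ for $x\in\mathfrak n_l$, $f\in\mathfrak n_k^*$, $y\in\mathfrak n_k$. Put $\widehat N_k=\bigcup_{l\ge k}\rho_k^l(N_l)$. Restriction of linear forms $\mathfrak n_{k+1}^*\to\mathfrak n_k^*$ induces homomorphisms $\widehat N_{k+1}\to\widehat N_k$; let $\widehat N=\varprojlim\widehat N_k$ be the adjoint pro-group. It acts on $\mathfrak n^*=\varprojlim\mathfrak n_k^*$ by $(g.\lambda)|_{\mathfrak n_k}=g_k.(\lambda|_{\mathfrak n_k})$ for $g=(g_k)_k\in\widehat N$ and all $k$. Then for all $\lambda,\mu\in\mathfrak n^*$ one has $I(\lambda)=I(\mu)$ if and only if $\widehat N.\lambda=\widehat N.\mu$. -/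

import Mathlib

noncomputable section

namespace SocleLie

universe u

/-! ### The Poisson algebra `S(n)` -/

section Poisson

variable {V : Type u} [AddCommGroup V] [Module ℂ V]

/-- The `ℂ`-linear derivation of `S(V)` whose restriction to `V` is a given linear map
`d : V → S(V)`. It is the second component of the algebra map
`S(V) → S(V) ⊕ ε S(V)` with `v ↦ v + ε d(v)`. -/
def derivationOf (d : V →ₗ[ℂ] SymmetricAlgebra ℂ V) :
    Derivation ℂ (SymmetricAlgebra ℂ V) (SymmetricAlgebra ℂ V) :=
  let F : SymmetricAlgebra ℂ V →ₐ[ℂ] TrivSqZeroExt (SymmetricAlgebra ℂ V) (SymmetricAlgebra ℂ V) :=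
    SymmetricAlgebra.lift
      ((TrivSqZeroExt.inlAlgHom ℂ (SymmetricAlgebra ℂ V) (SymmetricAlgebra ℂ V)).toLinearMap ∘ₗ
          SymmetricAlgebra.ι ℂ V
        + ((TrivSqZeroExt.inrHom (SymmetricAlgebra ℂ V) (SymmetricAlgebra ℂ V)).restrictScalars ℂ)
          ∘ₗ d)
  have hF : ∀ f, (F f).fst = f := fun f => by
    have h : (TrivSqZeroExt.fstHom ℂ (SymmetricAlgebra ℂ V) (SymmetricAlgebra ℂ V)).comp F
        = AlgHom.id ℂ _ := by
      apply SymmetricAlgebra.algHom_ext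
      ext v
      simp [F]
    exact congrArg (fun G : SymmetricAlgebra ℂ V →ₐ[ℂ] SymmetricAlgebra ℂ V => G f) h
  Derivation.mk'
    { toFun := fun f => (F f).snd
      map_add' := fun f g => by simp
      map_smul' := fun c f => by simp }
    (fun f g => by simp [hF, mul_comm])

theorem derivationOf_ι (d : V →ₗ[ℂ] SymmetricAlgebra ℂ V) (v : V) :
    derivationOf d (SymmetricAlgebra.ι ℂ V v) = d v := by
  simp [derivationOf]

theorem derivation_ext {D E : Derivation ℂ (SymmetricAlgebra ℂ V) (SymmetricAlgebra ℂ V)}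
    (h : ∀ v, D (SymmetricAlgebra.ι ℂ V v) = E (SymmetricAlgebra.ι ℂ V v)) : D = E := by
  ext f
  induction f using SymmetricAlgebra.induction with
  | algebraMap r => simp
  | ι x => exact h x
  | mul a b ha hb => simp [ha, hb]
  | add a b ha hb => simp [ha, hb]

variable {n : Type u} [LieRing n] [LieAlgebra ℂ n]

/-- For `x ∈ n`, the derivation `{x, ·}` of `S(n)`, determined by `y ↦ [x, y]` on `n`. -/
def bracketLeft (x : n) : Derivation ℂ (SymmetricAlgebra ℂ n) (SymmetricAlgebra ℂ n) :=
  derivationOf (SymmetricAlgebra.ι ℂ n ∘ₗ (LieAlgebra.ad ℂ n x))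

/-- For `g ∈ S(n)`, the derivation `{·, g}` of `S(n)`, determined by `x ↦ {x, g}` on `n`. -/
def bracketRight (g : SymmetricAlgebra ℂ n) :
    Derivation ℂ (SymmetricAlgebra ℂ n) (SymmetricAlgebra ℂ n) :=
  derivationOf
    { toFun := fun x => bracketLeft x g
      map_add' := fun x y => by
        have h : bracketLeft (x + y) = bracketLeft x + bracketLeft y :=
          derivation_ext fun v => by simp [bracketLeft, derivationOf_ι]
        simp [h]
      map_smul' := fun c x => by
        have h : bracketLeft (c • x) = c • bracketLeft x :=
          derivation_ext fun v => by simp [bracketLeft, derivationOf_ι]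
        simp [h] }

/-- The Poisson bracket on `S(n)`: the biderivation with `{x, y} = [x, y]` for `x, y ∈ n`. -/
def poissonBracket (f g : SymmetricAlgebra ℂ n) : SymmetricAlgebra ℂ n :=
  bracketRight g f

theorem poissonBracket_ι_left (x : n) (g : SymmetricAlgebra ℂ n) :
    poissonBracket (SymmetricAlgebra.ι ℂ n x) g = bracketLeft x g := by
  simp [poissonBracket, bracketRight, derivationOf_ι]

theorem poissonBracket_ι_ι (x y : n) :
    poissonBracket (SymmetricAlgebra.ι ℂ n x) (SymmetricAlgebra.ι ℂ n y)
      = SymmetricAlgebra.ι ℂ n ⁅x, y⁆ := by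
  simp [poissonBracket_ι_left, bracketLeft, derivationOf_ι]

theorem poissonBracket_add_left (f f' g : SymmetricAlgebra ℂ n) :
    poissonBracket (f + f') g = poissonBracket f g + poissonBracket f' g := by
  simp [poissonBracket]

theorem poissonBracket_smul_left (c : ℂ) (f g : SymmetricAlgebra ℂ n) :
    poissonBracket (c • f) g = c • poissonBracket f g := by
  simp [poissonBracket]

theorem poissonBracket_mul_left (f f' g : SymmetricAlgebra ℂ n) :
    poissonBracket (f * f') g = f * poissonBracket f' g + f' * poissonBracket f g := by
  simp [poissonBracket]

theorem poissonBracket_algebraMap_left (c : ℂ) (g : SymmetricAlgebra ℂ n) :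
    poissonBracket (algebraMap ℂ _ c) g = 0 := by
  simp [poissonBracket]

theorem poissonBracket_add_right (f g g' : SymmetricAlgebra ℂ n) :
    poissonBracket f (g + g') = poissonBracket f g + poissonBracket f g' := by
  induction f using SymmetricAlgebra.induction with
  | algebraMap r => simp [poissonBracket_algebraMap_left]
  | ι x => simp [poissonBracket_ι_left]
  | mul a b ha hb => rw [poissonBracket_mul_left, poissonBracket_mul_left,
      poissonBracket_mul_left, ha, hb]; ring
  | add a b ha hb => rw [poissonBracket_add_left, poissonBracket_add_left,
      poissonBracket_add_left, ha, hb]; ring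

theorem poissonBracket_mul_right (f g g' : SymmetricAlgebra ℂ n) :
    poissonBracket f (g * g') = g * poissonBracket f g' + g' * poissonBracket f g := by
  induction f using SymmetricAlgebra.induction with
  | algebraMap r => simp [poissonBracket_algebraMap_left]
  | ι x => simp [poissonBracket_ι_left]
  | mul a b ha hb => rw [poissonBracket_mul_left, poissonBracket_mul_left,
      poissonBracket_mul_left, ha, hb]; ring
  | add a b ha hb => rw [poissonBracket_add_left, poissonBracket_add_left,
      poissonBracket_add_left, ha, hb]; ring

/-- An ideal `I` of `S(n)` is Poisson if `{S(n), I} ⊆ I`. -/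
def IsPoissonIdeal (I : Ideal (SymmetricAlgebra ℂ n)) : Prop :=
  ∀ f, ∀ g ∈ I, poissonBracket f g ∈ I

/-- The maximal ideal `I_lam` of `S(n)`: the kernel of the evaluation `f ↦ f(lam)`. -/
def evalIdeal (lam : Module.Dual ℂ n) : Ideal (SymmetricAlgebra ℂ n) :=
  RingHom.ker (SymmetricAlgebra.lift lam : SymmetricAlgebra ℂ n →ₐ[ℂ] ℂ)

/-- The primitive Poisson ideal `I(lam)`: the largest Poisson ideal contained in `I_lam`
(see `isGreatest_primitiveIdeal`). -/
def primitiveIdeal (lam : Module.Dual ℂ n) : Ideal (SymmetricAlgebra ℂ n) :=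
  sSup {I | IsPoissonIdeal I ∧ I ≤ evalIdeal lam}

theorem isGreatest_primitiveIdeal (lam : Module.Dual ℂ n) :
    IsGreatest {I : Ideal (SymmetricAlgebra ℂ n) | IsPoissonIdeal I ∧ I ≤ evalIdeal lam}
      (primitiveIdeal lam) := by
  refine ⟨⟨fun f g hg => ?_, sSup_le fun I hI => hI.2⟩, fun I hI => le_sSup hI⟩
  unfold primitiveIdeal at hg ⊢
  rw [sSup_eq_iSup'] at hg ⊢
  refine Submodule.iSup_induction _ (motive := fun g => poissonBracket f g ∈ _) hg
    (fun I x hx => ?_) ?_ (fun x y hx hy => ?_)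
  · exact Submodule.mem_iSup_of_mem I (I.2.1 f x hx)
  · have h0 : poissonBracket f (0 : SymmetricAlgebra ℂ n) = 0 := by
      simpa using poissonBracket_add_right f 0 0
    rw [h0]
    exact Submodule.zero_mem _
  · rw [poissonBracket_add_right]
    exact Submodule.add_mem _ hx hy

end Poisson

/-! ### Socle Lie algebras and the adjoint pro-group -/

/-- An exhaustion of a complex Lie algebra `n` by a chain of finite-dimensional nilpotent ideals;
`n` is a socle Lie algebra if it has one. -/
structure SocleExhaustion (n : Type u) [LieRing n] [LieAlgebra ℂ n] where
  /-- the members of the chain -/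
  ideal : ℕ → LieIdeal ℂ n
  mono : Monotone ideal
  finiteDimensional : ∀ k, FiniteDimensional ℂ (ideal k)
  nilpotent : ∀ k, LieRing.IsNilpotent (ideal k)
  exhausts : ∀ x : n, ∃ k, x ∈ ideal k

namespace SocleExhaustion

variable {n : Type u} [LieRing n] [LieAlgebra ℂ n] (E : SocleExhaustion n)

/-- The operator by which `x ∈ n` acts on `n_k^*` in the coadjoint representation:
`(x . f)(y) = - f([x, y])`. -/
def coad (k : ℕ) (x : n) : Module.End ℂ (Module.Dual ℂ (E.ideal k)) :=
  LieModule.toEnd ℂ n (Module.Dual ℂ (E.ideal k)) x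

theorem coad_apply (k : ℕ) (x : n) (f : Module.Dual ℂ (E.ideal k)) (y : E.ideal k) :
    E.coad k x f y = - f ⁅x, y⁆ := rfl

theorem isNilpotent_coad (k : ℕ) (x : n) : IsNilpotent (E.coad k x) := by
  obtain ⟨l, hl⟩ := E.exhausts x
  have hx : x ∈ E.ideal (max k l) := E.mono (le_max_right k l) hl
  have hk : E.ideal k ≤ E.ideal (max k l) := E.mono (le_max_left k l)
  have := E.nilpotent (max k l)
  obtain ⟨r, hr⟩ := LieModule.exists_forall_pow_toEnd_eq_zero
    (L := E.ideal (max k l)) (M := E.ideal (max k l)) (R := ℂ)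
  have h1 : ∀ (i : ℕ) (y : E.ideal k),
      (((LieModule.toEnd ℂ n (E.ideal k) x ^ i) y : E.ideal k) : n)
        = ((LieModule.toEnd ℂ (E.ideal (max k l)) (E.ideal (max k l)) ⟨x, hx⟩ ^ i)
            ⟨y, hk y.2⟩ : E.ideal (max k l)) := by
    intro i
    induction i with
    | zero => intro y; simp
    | succ i ih => intro y; rw [pow_succ', pow_succ']; simp [ih]
  have h2 : ∀ (i : ℕ) (f : Module.Dual ℂ (E.ideal k)) (y : E.ideal k),
      (E.coad k x ^ i) f y
        = (-1 : ℂ) ^ i * f ((LieModule.toEnd ℂ n (E.ideal k) x ^ i) y) := by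
    intro i
    induction i with
    | zero => intro f y; simp
    | succ i ih =>
      intro f y
      rw [pow_succ (E.coad k x), pow_succ' (LieModule.toEnd ℂ n (E.ideal k) x),
        pow_succ (-1 : ℂ)]
      simp [ih, coad_apply]
  refine ⟨r, LinearMap.ext fun f => LinearMap.ext fun y => ?_⟩
  have h3 : (LieModule.toEnd ℂ n (E.ideal k) x ^ r) y = 0 := by
    apply Subtype.ext
    rw [h1, hr]
    simp
  simp [h2, h3]

/-- The coadjoint action on `n_k^*` of the group element `exp x`, where `x ∈ n`. -/
def coadExp (k : ℕ) (x : n) :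
    LinearMap.GeneralLinearGroup ℂ (Module.Dual ℂ (E.ideal k)) :=
  (IsNilpotent.isUnit_exp (E.isNilpotent_coad k x)).unit

theorem coe_coadExp (k : ℕ) (x : n) :
    (E.coadExp k x : Module.End ℂ (Module.Dual ℂ (E.ideal k))) = IsNilpotent.exp (E.coad k x) :=
  rfl

/-- The image `ρ_k^l(N_l) ⊆ GL(n_k^*)` of the unipotent group `N_l = Exp n_l` under the coadjoint
action. As `N_l` is generated by (in fact consists of) the elements `exp x` with `x ∈ n_l`, its
image is the subgroup generated by the operators `exp (ad^* x)` on `n_k^*`. -/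
def groupImage (k l : ℕ) :
    Subgroup (LinearMap.GeneralLinearGroup ℂ (Module.Dual ℂ (E.ideal k))) :=
  Subgroup.closure (E.coadExp k '' (E.ideal l : Set n))

theorem groupImage_mono (k : ℕ) : Monotone (E.groupImage k) := fun _ _ h =>
  Subgroup.closure_mono (Set.image_mono (E.mono h))

/-- The group `N̂_k = ⋃_{l ≥ k} ρ_k^l(N_l) ⊆ GL(n_k^*)`; the supremum is a union, see
`mem_proGroupLevel`. -/
def proGroupLevel (k : ℕ) :
    Subgroup (LinearMap.GeneralLinearGroup ℂ (Module.Dual ℂ (E.ideal k))) :=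
  ⨆ l : {l : ℕ // k ≤ l}, E.groupImage k l

theorem mem_proGroupLevel (k : ℕ)
    (g : LinearMap.GeneralLinearGroup ℂ (Module.Dual ℂ (E.ideal k))) :
    g ∈ E.proGroupLevel k ↔ ∃ l, k ≤ l ∧ g ∈ E.groupImage k l := by
  have : Nonempty {l : ℕ // k ≤ l} := ⟨⟨k, le_rfl⟩⟩
  have hd : Directed (· ≤ ·) (fun l : {l : ℕ // k ≤ l} => E.groupImage k l) := fun a b =>
    ⟨⟨max a b, a.2.trans (le_max_left _ _)⟩, E.groupImage_mono k (le_max_left _ _),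
      E.groupImage_mono k (le_max_right _ _)⟩
  rw [proGroupLevel, Subgroup.mem_iSup_of_directed hd]
  simp

/-- The restriction map `n_l^* → n_k^*` for `k ≤ l`. -/
def restrict {k l : ℕ} (h : k ≤ l) :
    Module.Dual ℂ (E.ideal l) →ₗ[ℂ] Module.Dual ℂ (E.ideal k) :=
  (Submodule.inclusion (show (E.ideal k).toSubmodule ≤ (E.ideal l).toSubmodule from
    E.mono h)).dualMap

/-- The pro-group `N̂ = lim N̂_k`. The transition map `N̂_l → N̂_k` sends `g` to the operator that
`g` induces on the quotient `n_k^*` of `n_l^*`; thus `N̂` consists of the sequences of elements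
`g_k ∈ N̂_k` that commute with the restriction maps `n_l^* → n_k^*`. -/
def proGroup :
    Subgroup (∀ k, LinearMap.GeneralLinearGroup ℂ (Module.Dual ℂ (E.ideal k))) where
  carrier := {g | (∀ k, g k ∈ E.proGroupLevel k) ∧
    ∀ (k l : ℕ) (h : k ≤ l) (f : Module.Dual ℂ (E.ideal l)),
      E.restrict h ((g l).val f) = (g k).val (E.restrict h f)}
  mul_mem' := fun {a b} ha hb =>
    ⟨fun k => mul_mem (ha.1 k) (hb.1 k), fun k l h f => by
      simp [Module.End.mul_apply, ha.2 k l h, hb.2 k l h]⟩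
  one_mem' := ⟨fun k => one_mem _, fun k l h f => by simp⟩
  inv_mem' := fun {a} ha =>
    ⟨fun k => inv_mem (ha.1 k), fun k l h f => by
      have e1 : ∀ v, (a l).val ((a⁻¹ l).val v) = v := fun v => by
        rw [← Module.End.mul_apply, ← Units.val_mul]; simp
      have e2 : ∀ v, (a⁻¹ k).val ((a k).val v) = v := fun v => by
        rw [← Module.End.mul_apply, ← Units.val_mul]; simp
      have := ha.2 k l h ((a⁻¹ l).val f)
      rw [e1] at this
      rw [this, e2]⟩

/-- The restriction `lam_k` of a linear form on `n` to `n_k`. -/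
def restrictTo (k : ℕ) (lam : Module.Dual ℂ n) : Module.Dual ℂ (E.ideal k) :=
  lam ∘ₗ (E.ideal k).toSubmodule.subtype

theorem restrict_restrictTo {k l : ℕ} (h : k ≤ l) (lam : Module.Dual ℂ n) :
    E.restrict h (E.restrictTo l lam) = E.restrictTo k lam := rfl


theorem act_value_eq (g : E.proGroup) (lam : Module.Dual ℂ n) {k l : ℕ} (y : n)
    (hk : y ∈ E.ideal k) (hl : y ∈ E.ideal l) :
    (g.1 k).val (E.restrictTo k lam) ⟨y, hk⟩ = (g.1 l).val (E.restrictTo l lam) ⟨y, hl⟩ := by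
  have key : ∀ (a b : ℕ) (h : a ≤ b) (ha : y ∈ E.ideal a) (hb : y ∈ E.ideal b),
      (g.1 a).val (E.restrictTo a lam) ⟨y, ha⟩ = (g.1 b).val (E.restrictTo b lam) ⟨y, hb⟩ := by
    intro a b h ha hb
    rw [← E.restrict_restrictTo h, ← g.2.2 a b h]
    rfl
  rcases le_total k l with h | h
  · exact key k l h hk hl
  · exact (key l k h hl hk).symm

/-- The action of `g ∈ N̂` on `n^* = lim n_k^*`: the linear form `g . lam` is the one whose
restriction to `n_k` is `g_k . lam_k` for every `k` (see `restrictTo_act`). -/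
def act (g : E.proGroup) (lam : Module.Dual ℂ n) : Module.Dual ℂ n where
  toFun y := (g.1 (E.exhausts y).choose).val (E.restrictTo _ lam) ⟨y, (E.exhausts y).choose_spec⟩
  map_add' y z := by
    obtain ⟨a, ha⟩ := E.exhausts y
    obtain ⟨b, hb⟩ := E.exhausts z
    have hy : y ∈ E.ideal (max a b) := E.mono (le_max_left a b) ha
    have hz : z ∈ E.ideal (max a b) := E.mono (le_max_right a b) hb
    rw [E.act_value_eq g lam (y + z) _ (add_mem hy hz), E.act_value_eq g lam y _ hy,
      E.act_value_eq g lam z _ hz, ← map_add]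
    rfl
  map_smul' c y := by
    obtain ⟨a, ha⟩ := E.exhausts y
    rw [E.act_value_eq g lam (c • y) _ ((E.ideal a).smul_mem c ha), E.act_value_eq g lam y _ ha,
      RingHom.id_apply, ← map_smul]
    rfl

theorem restrictTo_act (g : E.proGroup) (lam : Module.Dual ℂ n) (k : ℕ) :
    E.restrictTo k (E.act g lam) = (g.1 k).val (E.restrictTo k lam) :=
  LinearMap.ext fun y => E.act_value_eq g lam y.1 _ y.2

theorem ext_restrictTo {lam mu : Module.Dual ℂ n}
    (h : ∀ k, E.restrictTo k lam = E.restrictTo k mu) : lam = mu :=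
  LinearMap.ext fun y => by
    obtain ⟨k, hk⟩ := E.exhausts y
    exact congrArg (fun f : Module.Dual ℂ (E.ideal k) => f ⟨y, hk⟩) (h k)

/-- The action of the pro-group `N̂` on `n^*`. -/
instance proGroupAction : MulAction E.proGroup (Module.Dual ℂ n) where
  smul := E.act
  one_smul lam := E.ext_restrictTo fun k => (E.restrictTo_act 1 lam k).trans (by simp)
  mul_smul g h lam := E.ext_restrictTo fun k => by
    refine (E.restrictTo_act (g * h) lam k).trans ?_
    refine Eq.trans ?_ (E.restrictTo_act g (E.act h lam) k).symm
    rw [E.restrictTo_act h lam k]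
    rfl

end SocleExhaustion

end SocleLie

end

/-! The ideal `I(λ)` is the vanishing ideal of the orbit of `λ` (`primitiveIdeal_eq_orbitIdeal`).
For a Poisson ideal `I` inside `I_λ` and `f ∈ I`, the entire function `t ↦ f(exp(tx).λ)` has all its
derivatives at `0` equal, up to sign, to values at `λ` of iterated brackets of `f` with `x`. These
values vanish, so `I` vanishes on the orbit. Conversely the vanishing ideal of an orbit is Poisson,
by differentiating along `exp(tx)`. Hence equal orbits give equal ideals.

Suppose now that `I(λ) = I(μ)`. At level `k` every polynomial vanishing on the orbit of `λ|n_k`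
vanishes at `μ|n_k`. Orbits of unipotent groups are closed (`mem_orbit_of_forall_polynomial`), so
the two restrictions are conjugate (`exists_restrictTo_smul_eq`). The conjugating elements must
still be made compatible. They are ambiguous only up to the stabilizers of the restrictions `λ|n_l`,
and such a stabilizer is generated by exponentials of the Lie stabilizer
(`mem_expMonoid_of_apply_eq`). The images of the Lie stabilizers in `End(n_k^*)` form a decreasing
chain of finite-dimensional spaces, which becomes stationary. This is the Mittag-Leffler condition
(`exists_stabilizer_lift`), and a successive correction yields an element of the inverse limit
(`exists_smul_eq`).

The facts about unipotent groups rest on one factorization: if commutators of `G` lie in `H`, then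
every product of exponentials from `G` is `h * exp x` with `h` a product of exponentials from `H`
and `x ∈ G` (`exists_eq_mul_exp`). It comes from a linear differential equation and is applied along
a filtration on which `G` is strictly triangular. -/

noncomputable section

/-! ### Exponentials of nilpotent elements: derivatives and conjugation. -/

namespace IsNilpotent

theorem exp_eq_normedSpace_exp {R : Type*} [NormedRing R] [NormedAlgebra ℂ R] [Module ℚ R]
    {x : R} (hx : IsNilpotent x) : IsNilpotent.exp x = NormedSpace.exp x := by
  obtain ⟨k, hk⟩ := hx
  rw [exp_eq_sum hk, NormedSpace.exp_eq_tsum ℂ]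
  dsimp only
  rw [tsum_eq_sum (s := Finset.range k)]
  · refine Finset.sum_congr rfl fun i _ => ?_
    rw [← Rat.cast_smul_eq_qsmul ℂ]
    simp
  · intro i hi
    rw [pow_eq_zero_of_le (by simpa using hi) hk, smul_zero]

theorem hasDerivAt_exp_smul {R : Type*} [NormedRing R] [NormedAlgebra ℂ R] [CompleteSpace R]
    [Module ℚ R] {x : R} (hx : IsNilpotent x) (z : ℂ) :
    HasDerivAt (fun w : ℂ => IsNilpotent.exp (w • x)) (x * IsNilpotent.exp (z • x)) z := by
  have h := hasDerivAt_exp_smul_const' (𝕂 := ℂ) x z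
  rw [exp_eq_normedSpace_exp (hx.smul z)]
  refine h.congr_of_eventuallyEq (Filter.Eventually.of_forall fun w => ?_)
  exact exp_eq_normedSpace_exp (hx.smul w)

theorem hasDerivAt_exp_comp_smul {R : Type*} [NormedRing R] [NormedAlgebra ℂ R] [CompleteSpace R]
    [Module ℚ R] {x : R} (hx : IsNilpotent x) {A : ℝ → ℂ} {a : ℂ} {t : ℝ}
    (hA : HasDerivAt A a t) :
    HasDerivAt (fun s : ℝ => IsNilpotent.exp (A s • x)) (a • (x * IsNilpotent.exp (A t • x))) t :=
  (hasDerivAt_exp_smul hx (A t)).scomp t hA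

section Conjugation

variable {R : Type*} [Ring R] [Algebra ℂ R] [Module ℚ R] {x : R}

/-- This is `exp(ad x) = Ad(exp x)`: left and right multiplications commute, so the exponential of
their difference factors. -/
theorem exp_mulLeft_sub_mulRight (hx : IsNilpotent x) (w : R) :
    IsNilpotent.exp (LinearMap.mulLeft ℂ x - LinearMap.mulRight ℂ x) w
      = IsNilpotent.exp x * w * IsNilpotent.exp (-x) := by
  obtain ⟨k, hk⟩ := hx
  have hl : LinearMap.mulLeft ℂ x ^ k = 0 := by simp [LinearMap.pow_mulLeft, hk]
  have hr : LinearMap.mulRight ℂ (-x) ^ k = 0 := by simp [LinearMap.pow_mulRight, neg_pow x, hk]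
  have hkn : (-x) ^ k = 0 := by rw [neg_pow, hk, mul_zero]
  have e : LinearMap.mulLeft ℂ x - LinearMap.mulRight ℂ x
      = LinearMap.mulLeft ℂ x + LinearMap.mulRight ℂ (-x) := by
    ext; simp [sub_eq_add_neg]
  rw [e, exp_add_of_commute (LinearMap.commute_mulLeft_right x (-x)) ⟨k, hl⟩ ⟨k, hr⟩,
    exp_eq_sum hl, exp_eq_sum hr, exp_eq_sum hk, exp_eq_sum hkn]
  simp only [Module.End.mul_apply, LinearMap.sum_apply, ← Rat.cast_smul_eq_qsmul ℂ,
    LinearMap.smul_apply, LinearMap.pow_mulLeft, LinearMap.pow_mulRight, LinearMap.mulLeft_apply,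
    LinearMap.mulRight_apply, ← smul_mul_assoc, ← Finset.sum_mul]
  rw [mul_assoc, Finset.mul_sum (a := w)]
  congr 1
  exact Finset.sum_congr rfl fun i _ => by simp

theorem exp_mul_mul_exp_neg_sub_mem (hx : IsNilpotent x) (H : Submodule ℂ R)
    (hH : ∀ w ∈ H, x * w - w * x ∈ H) {w : R} (hw : x * w - w * x ∈ H) :
    IsNilpotent.exp x * w * IsNilpotent.exp (-x) - w ∈ H := by
  rw [← exp_mulLeft_sub_mulRight hx]
  set D := LinearMap.mulLeft ℂ x - LinearMap.mulRight ℂ x with hD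
  have hnil : IsNilpotent D :=
    Commute.isNilpotent_sub (LinearMap.commute_mulLeft_right x x)
      (by simpa using hx) (by simpa using hx)
  obtain ⟨k, hk⟩ := hnil
  have hpow : ∀ i, (D ^ (i + 1)) w ∈ H := by
    intro i
    induction i with
    | zero => simpa [hD] using hw
    | succ i ih => rw [pow_succ']; simpa [hD] using hH _ ih
  rw [exp_eq_sum (pow_eq_zero_of_le (Nat.le_succ k) hk), Finset.sum_range_succ']
  simp only [← Rat.cast_smul_eq_qsmul ℂ, LinearMap.add_apply, LinearMap.sum_apply,
    LinearMap.smul_apply]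
  simp only [Nat.factorial_zero, pow_zero, Nat.cast_one, inv_one, Rat.cast_one, one_smul,
    Module.End.one_apply, add_sub_cancel_right]
  exact H.sum_mem fun i _ => H.smul_mem _ (hpow i)

theorem exp_mul_mul_exp_neg_mem (hx : IsNilpotent x) (H : Submodule ℂ R)
    (hH : ∀ w ∈ H, x * w - w * x ∈ H) {w : R} (hw : w ∈ H) :
    IsNilpotent.exp x * w * IsNilpotent.exp (-x) ∈ H := by
  simpa using H.add_mem (exp_mul_mul_exp_neg_sub_mem hx H hH (hH w hw)) hw

end Conjugation

end IsNilpotent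


/-! ### Products of exponentials from a nilpotent Lie subspace. -/

/-- The submonoid generated by the exponentials of the elements of a subspace. -/
def expMonoid {R : Type*} [Ring R] [Algebra ℂ R] [Module ℚ R] (H : Submodule ℂ R) : Submonoid R :=
  Submonoid.closure (IsNilpotent.exp '' (H : Set R))

/-- A subspace closed under commutators that consists of nilpotent elements and has no nonzero
perfect subspaces. -/
structure IsNilLieSubspace {R : Type*} [Ring R] [Algebra ℂ R] (H : Submodule ℂ R) : Prop where
  commutator_mem : ∀ x ∈ H, ∀ y ∈ H, x * y - y * x ∈ H
  isNilpotent : ∀ x ∈ H, IsNilpotent x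
  eq_bot_of_perfect : ∀ K ≤ H,
    K ≤ Submodule.span ℂ {z | ∃ x ∈ K, ∃ y ∈ K, z = x * y - y * x} → K = ⊥

/-- Perfectness is tested on all subspaces of `K`, which makes the condition hereditary and so fit
for induction on dimension. -/
theorem IsNilLieSubspace.mono {R : Type*} [Ring R] [Algebra ℂ R] {H K : Submodule ℂ R} (hK : IsNilLieSubspace K) (h : H ≤ K)
    (hc : ∀ x ∈ H, ∀ y ∈ H, x * y - y * x ∈ H) : IsNilLieSubspace H :=
  ⟨hc, fun x hx => hK.isNilpotent x (h hx), fun L hL => hK.eq_bot_of_perfect L (hL.trans h)⟩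

section Monoid

variable {R : Type*} [Ring R] [Algebra ℂ R] [Module ℚ R]

theorem expMonoid_mono {H K : Submodule ℂ R} (h : H ≤ K) : expMonoid H ≤ expMonoid K :=
  Submonoid.closure_mono (Set.image_mono h)

theorem exp_mem_expMonoid {H : Submodule ℂ R} {x : R} (hx : x ∈ H) :
    IsNilpotent.exp x ∈ expMonoid H :=
  Submonoid.subset_closure ⟨x, hx, rfl⟩

theorem conj_mem_expMonoid {H : Submodule ℂ R} (hn : ∀ y ∈ H, IsNilpotent y) {x : R}
    (hx : IsNilpotent x)
    (hH : ∀ w ∈ H, x * w - w * x ∈ H) {g : R} (hg : g ∈ expMonoid H) :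
    IsNilpotent.exp x * g * IsNilpotent.exp (-x) ∈ expMonoid H := by
  have e1 := IsNilpotent.exp_mul_exp_neg_self hx
  have e2 := IsNilpotent.exp_neg_mul_exp_self hx
  induction hg using Submonoid.closure_induction with
  | mem g hg =>
    obtain ⟨y, hy, rfl⟩ := hg
    let u : Rˣ := ⟨IsNilpotent.exp x, IsNilpotent.exp (-x), e1, e2⟩
    have := IsNilpotent.exp_smul (A := R) (ConjAct.toConjAct u) (hn y hy)
    rw [ConjAct.units_smul_def, ConjAct.units_smul_def] at this
    change IsNilpotent.exp (IsNilpotent.exp x * y * IsNilpotent.exp (-x))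
      = IsNilpotent.exp x * IsNilpotent.exp y * IsNilpotent.exp (-x) at this
    rw [← this]
    exact exp_mem_expMonoid (IsNilpotent.exp_mul_mul_exp_neg_mem hx H hH hy)
  | one => rw [mul_one, e1]; exact one_mem _
  | mul a b _ _ ha hb =>
    have : IsNilpotent.exp x * (a * b) * IsNilpotent.exp (-x)
        = (IsNilpotent.exp x * a * IsNilpotent.exp (-x))
          * (IsNilpotent.exp x * b * IsNilpotent.exp (-x)) := by
      calc _ = IsNilpotent.exp x * a * 1 * b * IsNilpotent.exp (-x) := by noncomm_ring
        _ = _ := by rw [← e2]; noncomm_ring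
    rw [this]
    exact mul_mem ha hb

end Monoid

/-! ### Solutions of linear differential equations as products of exponentials. -/

section ODE

variable {R : Type*} [NormedRing R] [NormedAlgebra ℂ R] [FiniteDimensional ℂ R] [Module ℚ R]

/-- Induction on `dim H`: a factor `exp(A(t)x)` is split off so that the remaining factor satisfies
an equation of the same kind with coefficients in a hyperplane of `H`. -/
theorem mem_expMonoid_of_hasDerivAt (d : ℕ) (H : Submodule ℂ R) (hH : IsNilLieSubspace H)
    (hd : Module.finrank ℂ H ≤ d) (u p : ℝ → R) (hu : Continuous u) (huH : ∀ t, u t ∈ H)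
    (hp : ∀ t, HasDerivAt p (u t * p t) t) (hp0 : p 0 = 1) (t : ℝ) : p t ∈ expMonoid H := by
  have : CompleteSpace R := FiniteDimensional.complete ℂ R
  induction d generalizing H u p with
  | zero =>
    have hbot : H = ⊥ := Submodule.finrank_eq_zero.mp (Nat.le_zero.mp hd)
    have hconst : p t = p 0 := by
      refine is_const_of_deriv_eq_zero (fun s => (hp s).differentiableAt) (fun s => ?_) t 0
      have : u s = 0 := by simpa [hbot] using huH s
      rw [(hp s).deriv, this, zero_mul]
    rw [hconst, hp0]
    exact one_mem _
  | succ d ih =>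
    by_cases hbot : H = ⊥
    · exact ih H hH (by rw [hbot, finrank_bot]; exact Nat.zero_le d) u p hu huH hp hp0
    have hnot : ¬ H ≤ Submodule.span ℂ {z | ∃ x ∈ H, ∃ y ∈ H, z = x * y - y * x} :=
      fun h => hbot (hH.eq_bot_of_perfect H le_rfl h)
    obtain ⟨x, hxH, hxD⟩ := SetLike.not_le_iff_exists.mp hnot
    obtain ⟨f, hfx, hfD⟩ := Submodule.exists_le_ker_of_notMem hxD
    -- The form `f` kills all commutators of `H` but not `x`; hence `K` is a proper subspace of `H`
    -- containing every commutator.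
    set K : Submodule ℂ R := H ⊓ LinearMap.ker f with hK
    have hKH : K ≤ H := inf_le_left
    have hcomm : ∀ a ∈ H, ∀ b ∈ H, a * b - b * a ∈ K := fun a ha b hb =>
      ⟨hH.commutator_mem a ha b hb, hfD (Submodule.subset_span ⟨a, ha, b, hb, rfl⟩)⟩
    have hKnil : IsNilLieSubspace K :=
      hH.mono hKH fun a ha b hb => hcomm a (hKH ha) b (hKH hb)
    have hlt : K < H := lt_of_le_of_ne hKH fun h => hfx (by
      have : x ∈ K := h ▸ hxH
      exact this.2)
    have hfr : Module.finrank ℂ K ≤ d :=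
      Nat.lt_succ_iff.mp ((Submodule.finrank_lt_finrank_of_lt hlt).trans_le hd)
    have hxn := hH.isNilpotent x hxH
    have hfc : Continuous f := f.continuous_of_finiteDimensional
    -- This coefficient gives `f (u s - a s • x) = 0`; its primitive `A` is the exponent of the
    -- factor to be removed.
    set a : ℝ → ℂ := fun s => (f x)⁻¹ * f (u s) with ha
    have hac : Continuous a := by fun_prop
    set A : ℝ → ℂ := fun s => ∫ r in (0 : ℝ)..s, a r with hA
    have hAd : ∀ s, HasDerivAt A (a s) s := fun s => hac.integral_hasStrictDerivAt 0 s |>.hasDerivAt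
    have hAc : Continuous A := continuous_iff_continuousAt.mpr fun s => (hAd s).continuousAt
    have e1 : ∀ s, IsNilpotent.exp (A s • x) * IsNilpotent.exp (-(A s • x)) = 1 := fun s =>
      IsNilpotent.exp_mul_exp_neg_self (hxn.smul _)
    have e2 : ∀ s, IsNilpotent.exp (-(A s • x)) * IsNilpotent.exp (A s • x) = 1 := fun s =>
      IsNilpotent.exp_neg_mul_exp_self (hxn.smul _)
    have hxK : ∀ s, ∀ w ∈ K, -(A s • x) * w - w * -(A s • x) ∈ K := fun s w hw =>
      hcomm _ (H.neg_mem (H.smul_mem _ hxH)) _ (hKH hw)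
    have hdneg : ∀ s, HasDerivAt (fun s => IsNilpotent.exp (-(A s • x)))
        (-(a s • (x * IsNilpotent.exp (-(A s • x))))) s := fun s => by
      have := IsNilpotent.hasDerivAt_exp_comp_smul hxn (hAd s).neg
      simpa only [Pi.neg_apply, neg_smul] using this
    have hdpos : ∀ s, HasDerivAt (fun s => IsNilpotent.exp (A s • x))
        (a s • (x * IsNilpotent.exp (A s • x))) s := fun s =>
      IsNilpotent.hasDerivAt_exp_comp_smul hxn (hAd s)
    set v : ℝ → R := fun s => IsNilpotent.exp (-(A s • x)) * (u s - a s • x)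
      * IsNilpotent.exp (A s • x) with hv
    have hvc : Continuous v := by
      have c1 : Continuous fun s => IsNilpotent.exp (-(A s • x)) :=
        continuous_iff_continuousAt.mpr fun s => (hdneg s).continuousAt
      have c2 : Continuous fun s => IsNilpotent.exp (A s • x) :=
        continuous_iff_continuousAt.mpr fun s => (hdpos s).continuousAt
      fun_prop
    have hvK : ∀ s, v s ∈ K := fun s => by
      have h1 : u s - a s • x ∈ K := by
        refine ⟨H.sub_mem (huH s) (H.smul_mem _ hxH), ?_⟩
        simp only [SetLike.mem_coe, LinearMap.mem_ker, map_sub, map_smul, ha, smul_eq_mul]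
        field_simp
        simp
      have h2 := IsNilpotent.exp_mul_mul_exp_neg_mem (x := -(A s • x)) (hxn.smul _).neg K (hxK s) h1
      rwa [neg_neg] at h2
    have hq : ∀ s, HasDerivAt (fun s => IsNilpotent.exp (-(A s • x)) * p s)
        (v s * (IsNilpotent.exp (-(A s • x)) * p s)) s := fun s => by
      convert! (hdneg s).mul (hp s) using 1
      have hcx : x * IsNilpotent.exp (-(A s • x)) = IsNilpotent.exp (-(A s • x)) * x := by
        have hc : Commute (-(A s • x)) x := ((Commute.refl x).smul_left _).neg_left
        obtain ⟨k, hk⟩ := (hxn.smul (A s)).neg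
        rw [IsNilpotent.exp_eq_sum hk]
        refine (Commute.sum_right _ _ _ fun i _ => ?_)
        exact ((hc.pow_left i).symm.smul_right _)
      calc v s * (IsNilpotent.exp (-(A s • x)) * p s)
          = IsNilpotent.exp (-(A s • x)) * (u s - a s • x)
            * (IsNilpotent.exp (A s • x) * IsNilpotent.exp (-(A s • x))) * p s := by
              simp only [hv, mul_assoc]
        _ = _ := by
            rw [e1, hcx, mul_one, mul_sub, sub_mul, mul_smul_comm, smul_mul_assoc]
            simp only [neg_mul, smul_mul_assoc, mul_assoc]
            abel
    have hmem := ih K hKnil hfr v _ hvc hvK hq (by simp [hp0, hA])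
    have : p t = IsNilpotent.exp (A t • x) * (IsNilpotent.exp (-(A t • x)) * p t) := by
      rw [← mul_assoc, e1, one_mul]
    rw [this]
    exact mul_mem (exp_mem_expMonoid (H.smul_mem _ hxH)) (expMonoid_mono hKH hmem)

/-- The path `exp(sx) exp(sy) exp(-s(x+y))` starts at `1`, and its logarithmic derivative lies in
`H` because conjugation by exponentials from `G` is trivial on `G` modulo `H`. -/
theorem exp_mul_exp_mem_of_normed {G H : Submodule ℂ R} (hG : IsNilLieSubspace G) (hHG : H ≤ G)
    (hGH : ∀ x ∈ G, ∀ y ∈ G, x * y - y * x ∈ H) {x y : R} (hx : x ∈ G) (hy : y ∈ G) :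
    IsNilpotent.exp x * IsNilpotent.exp y * IsNilpotent.exp (-(x + y)) ∈ expMonoid H := by
  have : CompleteSpace R := FiniteDimensional.complete ℂ R
  have hH : IsNilLieSubspace H := hG.mono hHG fun a ha b hb => hGH a (hHG ha) b (hHG hb)
  have hz : x + y ∈ G := G.add_mem hx hy
  have hder : ∀ w ∈ G, ∀ s : ℝ, HasDerivAt (fun s : ℝ => IsNilpotent.exp ((s : ℂ) • w))
      (w * IsNilpotent.exp ((s : ℂ) • w)) s := fun w hw s => by
    have h := IsNilpotent.hasDerivAt_exp_comp_smul (A := fun s : ℝ => (s : ℂ)) (t := s) (a := 1)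
      (hG.isNilpotent w hw) (Complex.ofRealCLM.hasDerivAt)
    simpa using h
  have hcont : ∀ w ∈ G, Continuous fun s : ℝ => IsNilpotent.exp ((s : ℂ) • w) := fun w hw =>
    continuous_iff_continuousAt.mpr fun s => (hder w hw s).continuousAt
  set e : R → ℝ → R := fun w s => IsNilpotent.exp ((s : ℂ) • w) with he
  have hinv : ∀ w ∈ G, ∀ s, e w s * e (-w) s = 1 := fun w hw s => by
    simp only [he, smul_neg]
    exact IsNilpotent.exp_mul_exp_neg_self ((hG.isNilpotent w hw).smul _)
  have hconj : ∀ w ∈ G, ∀ z ∈ G, ∀ s, e w s * z * e (-w) s - z ∈ H := fun w hw z hz s => by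
    simp only [he, smul_neg]
    have hsw : (s : ℂ) • w ∈ G := G.smul_mem _ hw
    exact IsNilpotent.exp_mul_mul_exp_neg_sub_mem (hG.isNilpotent _ hsw) H
      (fun a ha => hGH _ hsw a (hHG ha)) (hGH _ hsw _ hz)
  have hconjG : ∀ w ∈ G, ∀ z ∈ G, ∀ s, e w s * z * e (-w) s ∈ G := fun w hw z hz s => by
    simpa using G.add_mem (hHG (hconj w hw z hz s)) hz
  have hnx := G.neg_mem hx
  have hny := G.neg_mem hy
  have hnz := G.neg_mem hz
  set p : ℝ → R := fun s => e x s * e y s * e (-(x + y)) s with hp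
  set u : ℝ → R := fun s => x + e x s * y * e (-x) s
    - e x s * (e y s * (x + y) * e (-y) s) * e (-x) s with hu
  have key := mem_expMonoid_of_hasDerivAt (Module.finrank ℂ H) H hH le_rfl u p ?_ ?_ ?_ ?_ 1
  · simpa [hp, he] using key
  · have := hcont x hx
    have := hcont y hy
    have := hcont _ hnx
    have := hcont _ hny
    simp only [hu, he]
    fun_prop
  · intro s
    have h1 := hconj x hx y hy s
    have h2 := hconj y hy _ hz s
    have h3 := hconj x hx _ (hconjG y hy _ hz s) s
    -- The summands `x + y` cancel, leaving differences between elements of `G` and their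
    -- conjugates.
    have : u s = (e x s * y * e (-x) s - y)
        - ((e x s * (e y s * (x + y) * e (-y) s) * e (-x) s - e y s * (x + y) * e (-y) s)
          + (e y s * (x + y) * e (-y) s - (x + y))) := by
      simp only [hu]; abel
    rw [this]
    exact H.sub_mem h1 (H.add_mem h3 h2)
  · intro s
    convert! (((hder x hx s).mul (hder y hy s)).mul (hder _ hnz s)) using 1
    have ix : e (-x) s * e x s = 1 := by simpa using hinv _ hnx s
    have iy : e (-y) s * e y s = 1 := by simpa using hinv _ hny s
    change u s * (e x s * e y s * e (-(x + y)) s)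
      = (x * e x s * e y s + e x s * (y * e y s)) * e (-(x + y)) s
        + e x s * e y s * (-(x + y) * e (-(x + y)) s)
    calc u s * (e x s * e y s * e (-(x + y)) s)
        = x * e x s * e y s * e (-(x + y)) s
          + e x s * y * (e (-x) s * e x s) * e y s * e (-(x + y)) s
          - e x s * e y s * (x + y) * (e (-y) s * (e (-x) s * e x s) * e y s)
              * e (-(x + y)) s := by
            simp only [hu]; noncomm_ring
      _ = _ := by rw [ix, mul_one, mul_one, iy]; noncomm_ring
  · simp [hp, he]

end ODE


/-! ### Factorization of products of exponentials modulo commutators. -/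

section FiniteDimensionalAlgebra

variable {R : Type*} [Ring R] [Algebra ℂ R] [FiniteDimensional ℂ R] [Module ℚ R]

-- The statement involves no norm; one is borrowed from matrices through the regular representation.
open scoped Matrix.Norms.Operator in
theorem exp_mul_exp_mul_exp_neg_mem {G H : Submodule ℂ R} (hG : IsNilLieSubspace G) (hHG : H ≤ G)
    (hGH : ∀ x ∈ G, ∀ y ∈ G, x * y - y * x ∈ H) {x y : R} (hx : x ∈ G) (hy : y ∈ G) :
    IsNilpotent.exp x * IsNilpotent.exp y * IsNilpotent.exp (-(x + y)) ∈ expMonoid H := by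
  let b := Module.finBasis ℂ R
  let f : R →ₐ[ℂ] Matrix (Fin (Module.finrank ℂ R)) (Fin (Module.finrank ℂ R)) ℂ :=
    (LinearMap.toMatrixAlgEquiv b).toAlgHom.comp (Algebra.lmul ℂ R)
  have hf : Function.Injective f :=
    (LinearMap.toMatrixAlgEquiv b).injective.comp Algebra.lmul_injective
  let _ : NormedRing R := NormedRing.induced R _ f hf
  let _ : NormedAlgebra ℂ R := NormedAlgebra.induced ℂ R _ f
  exact exp_mul_exp_mem_of_normed hG hHG hGH hx hy

/-- Modulo `exp H` exponents simply add, and `exp H` is normalized by `exp G`. -/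
theorem exists_eq_mul_exp {G H : Submodule ℂ R} (hG : IsNilLieSubspace G) (hHG : H ≤ G)
    (hGH : ∀ x ∈ G, ∀ y ∈ G, x * y - y * x ∈ H) {g : R} (hg : g ∈ expMonoid G) :
    ∃ h ∈ expMonoid H, ∃ x ∈ G, g = h * IsNilpotent.exp x := by
  induction hg using Submonoid.closure_induction_left with
  | one => exact ⟨1, one_mem _, 0, G.zero_mem, by simp⟩
  | mul_left y hy g _ ih =>
    obtain ⟨y, hy, rfl⟩ := hy
    obtain ⟨h, hh, x, hx, rfl⟩ := ih
    have hyn := hG.isNilpotent y hy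
    refine ⟨(IsNilpotent.exp y * h * IsNilpotent.exp (-y))
      * (IsNilpotent.exp y * IsNilpotent.exp x * IsNilpotent.exp (-(y + x))), mul_mem ?_ ?_, y + x,
      G.add_mem hy hx, ?_⟩
    · exact conj_mem_expMonoid (fun z hz => hG.isNilpotent z (hHG hz)) hyn
        (fun w hw => hGH y hy w (hHG hw)) hh
    · exact exp_mul_exp_mul_exp_neg_mem hG hHG hGH hy hx
    · have e1 := IsNilpotent.exp_neg_mul_exp_self hyn
      have e2 := IsNilpotent.exp_neg_mul_exp_self (hG.isNilpotent _ (G.add_mem hy hx))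
      calc _ = IsNilpotent.exp y * h * 1 * IsNilpotent.exp x * 1 := by noncomm_ring
        _ = IsNilpotent.exp y * h * (IsNilpotent.exp (-y) * IsNilpotent.exp y) * IsNilpotent.exp x
            * (IsNilpotent.exp (-(y + x)) * IsNilpotent.exp (y + x)) := by rw [e1, e2]
        _ = _ := by simp only [mul_assoc]

end FiniteDimensionalAlgebra

/-! ### Strictly triangular Lie algebras and stabilizers modulo a filtration. -/

section Flag

variable {V : Type*} [AddCommGroup V] [Module ℂ V]

/-- A subspace of `End V` closed under commutators that acts strictly triangularly with respect to
a decreasing filtration of `V`. -/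
structure IsStrictlyTriangular (W : ℕ → Submodule ℂ V) (G : Submodule ℂ (Module.End ℂ V)) :
    Prop where
  antitone : Antitone W
  zero : W 0 = ⊤
  exists_eq_bot : ∃ N, W N = ⊥
  commutator_mem : ∀ x ∈ G, ∀ y ∈ G, x * y - y * x ∈ G
  apply_mem : ∀ x ∈ G, ∀ i, ∀ w ∈ W i, x w ∈ W (i + 1)

namespace IsStrictlyTriangular

variable {W : ℕ → Submodule ℂ V} {G : Submodule ℂ (Module.End ℂ V)}
  (h : IsStrictlyTriangular W G)

include h

theorem pow_apply_mem {x : Module.End ℂ V} (hx : x ∈ G) {i : ℕ} {w : V} (hw : w ∈ W i) (k : ℕ) :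
    (x ^ k) w ∈ W (i + k) := by
  induction k with
  | zero => simpa using hw
  | succ k ih => rw [pow_succ']; exact h.apply_mem x hx _ _ ih

theorem exists_pow_eq_zero : ∃ N, ∀ x ∈ G, x ^ N = 0 := by
  obtain ⟨N, hN⟩ := h.exists_eq_bot
  refine ⟨N, fun x hx => LinearMap.ext fun w => ?_⟩
  have := h.pow_apply_mem hx (i := 0) (w := w) (by simp [h.zero]) N
  rw [zero_add, hN] at this
  simpa using this

theorem isNilpotent {x : Module.End ℂ V} (hx : x ∈ G) : IsNilpotent x :=
  let ⟨N, hN⟩ := h.exists_pow_eq_zero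
  ⟨N, hN x hx⟩

theorem mono {H : Submodule ℂ (Module.End ℂ V)} (hHG : H ≤ G)
    (hc : ∀ x ∈ H, ∀ y ∈ H, x * y - y * x ∈ H) : IsStrictlyTriangular W H :=
  ⟨h.antitone, h.zero, h.exists_eq_bot, hc, fun x hx => h.apply_mem x (hHG hx)⟩

/-- Each passage to commutators raises the filtration shift, so a perfect subspace shifts by
arbitrarily much and is zero. -/
theorem isNilLieSubspace : IsNilLieSubspace G where
  commutator_mem := h.commutator_mem
  isNilpotent _ hx := h.isNilpotent hx
  eq_bot_of_perfect K hKG hK := by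
    have key : ∀ r, ∀ x ∈ K, ∀ i, ∀ w ∈ W i, x w ∈ W (i + r + 1) := by
      intro r
      induction r with
      | zero => exact fun x hx => h.apply_mem x (hKG hx)
      | succ r ih =>
        intro x hx i w hw
        have := hK hx
        clear hx
        induction this using Submodule.span_induction with
        | mem z hz =>
          obtain ⟨x, hx, y, hy, rfl⟩ := hz
          have h1 := ih x hx _ _ (ih y hy _ _ hw)
          have h2 := ih y hy _ _ (ih x hx _ _ hw)
          exact h.antitone (by omega) ((W _).sub_mem h1 h2)
        | zero => exact (W _).zero_mem
        | add a b _ _ ha hb => exact (W _).add_mem ha hb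
        | smul c a _ ha => exact (W _).smul_mem c ha
    obtain ⟨N, hN⟩ := h.exists_eq_bot
    rw [eq_bot_iff]
    intro x hx
    refine (Submodule.mem_bot ℂ).mpr (LinearMap.ext fun w => ?_)
    have h1 := key N x hx 0 w (by simp [h.zero])
    have h2 := h.antitone (show N ≤ 0 + N + 1 by omega) h1
    rw [hN] at h2
    simpa using h2

/-- The elements of `G` that move `v` into `W i`. -/
def transporter (_ : IsStrictlyTriangular W G) (v : V) (i : ℕ) : Submodule ℂ (Module.End ℂ V) :=
  G ⊓ (W i).comap (LinearMap.applyₗ v)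

omit h in
theorem mem_transporter (h : IsStrictlyTriangular W G) {v : V} {i : ℕ} {x : Module.End ℂ V} :
    x ∈ h.transporter v i ↔ x ∈ G ∧ x v ∈ W i := Iff.rfl

theorem transporter_le (v : V) (i : ℕ) : h.transporter v i ≤ G := inf_le_left

theorem transporter_antitone (v : V) : Antitone (h.transporter v) := fun _ _ hij _ hx =>
  ⟨hx.1, h.antitone hij hx.2⟩

/-- The gain of one step in the filtration is what allows `exists_eq_mul_exp` to be applied to
consecutive transporters. -/
theorem commutator_mem_transporter (v : V) (i : ℕ) : ∀ x ∈ h.transporter v i,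
    ∀ y ∈ h.transporter v i, x * y - y * x ∈ h.transporter v (i + 1) := fun x hx y hy =>
  ⟨h.commutator_mem x hx.1 y hy.1,
    (W _).sub_mem (h.apply_mem x hx.1 _ _ hy.2) (h.apply_mem y hy.1 _ _ hx.2)⟩

theorem transporter_isStrictlyTriangular (v : V) (i : ℕ) :
    IsStrictlyTriangular W (h.transporter v i) :=
  h.mono (h.transporter_le v i) fun x hx y hy =>
    h.transporter_antitone v (Nat.le_succ i) (h.commutator_mem_transporter v i x hx y hy)

variable [Module ℚ (Module.End ℂ V)]

theorem exp_apply_sub_mem {x : Module.End ℂ V} (hx : x ∈ G) {v : V} {i : ℕ} (hv : x v ∈ W i) :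
    IsNilpotent.exp x v - v - x v ∈ W (i + 1) := by
  obtain ⟨k, hk⟩ := h.isNilpotent hx
  rw [IsNilpotent.exp_eq_sum (pow_eq_zero_of_le (show k ≤ k + 2 by omega) hk),
    Finset.sum_range_succ', Finset.sum_range_succ']
  simp only [← Rat.cast_smul_eq_qsmul ℂ, LinearMap.add_apply, LinearMap.sum_apply,
    LinearMap.smul_apply]
  have : ∀ a b c : V, a + b + c - c - b = a := fun a b c => by abel
  simp only [zero_add, pow_zero, pow_one, Nat.factorial_zero, Nat.factorial_one, Nat.cast_one,
    inv_one, Rat.cast_one, one_smul, Module.End.one_apply, this]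
  refine (W _).sum_mem fun j _ => (W _).smul_mem _ ?_
  rw [pow_succ]
  exact h.antitone (by omega) (h.pow_apply_mem hx hv (j + 1))

theorem expMonoid_apply_sub_mem {g : Module.End ℂ V} (hg : g ∈ expMonoid G) {i : ℕ} {w : V}
    (hw : w ∈ W i) : g w - w ∈ W (i + 1) := by
  induction hg using Submonoid.closure_induction generalizing w with
  | mem g hg =>
    obtain ⟨x, hx, rfl⟩ := hg
    have h1 := h.apply_mem x hx i w hw
    simpa using (W _).add_mem (h.antitone (Nat.le_succ _) (h.exp_apply_sub_mem hx h1)) h1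
  | one => simp
  | mul a b _ _ ha hb =>
    have h1 := hb hw
    have h2 := ha ((W i).add_mem (h.antitone (Nat.le_succ i) h1) hw)
    rw [sub_add_cancel] at h2
    simpa using (W _).add_mem h2 h1

theorem expMonoid_apply_mem {g : Module.End ℂ V} (hg : g ∈ expMonoid G) {i : ℕ} {w : V}
    (hw : w ∈ W i) : g w ∈ W i := by
  simpa using (W _).add_mem (h.antitone (Nat.le_succ i) (h.expMonoid_apply_sub_mem hg hw)) hw

theorem expMonoid_transporter_apply_sub_mem {v : V} {i : ℕ} {g : Module.End ℂ V}
    (hg : g ∈ expMonoid (h.transporter v i)) : g v - v ∈ W i := by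
  induction hg using Submonoid.closure_induction with
  | mem g hg =>
    obtain ⟨x, hx, rfl⟩ := hg
    simpa using (W _).add_mem (h.antitone (Nat.le_succ _) (h.exp_apply_sub_mem hx.1 hx.2)) hx.2
  | one => simp
  | mul a b ha' _ ha hb =>
    have h1 := h.expMonoid_apply_mem (expMonoid_mono (h.transporter_le v i) ha') hb
    rw [map_sub] at h1
    simpa using (W _).add_mem h1 ha

/-- Modulo `W (i + 1)` the factor `g` fixes both `v` and `x v ∈ W i`, so only the exponent `x` is
visible in the displacement of `v`. -/
theorem mul_exp_apply_sub_mem {v : V} {i : ℕ} {g x : Module.End ℂ V}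
    (hg : g ∈ expMonoid (h.transporter v (i + 1))) (hx : x ∈ h.transporter v i) :
    (g * IsNilpotent.exp x) v - v - x v ∈ W (i + 1) := by
  have hgG := expMonoid_mono (h.transporter_le v (i + 1)) hg
  have h1 := h.exp_apply_sub_mem hx.1 hx.2
  have h2 := h.expMonoid_apply_mem hgG h1
  have h3 := h.expMonoid_transporter_apply_sub_mem hg
  have h4 := h.expMonoid_apply_sub_mem hgG hx.2
  simp only [map_sub] at h2
  have := (W _).add_mem (W _ |>.add_mem h2 h3) h4
  rw [Module.End.mul_apply]
  convert! this using 1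
  simp only [LinearMap.applyₗ_apply_apply]
  abel

variable [FiniteDimensional ℂ V]

/-- The elements of the group `exp G` that fix `v` modulo `W i` are products of exponentials of
elements of `G` that kill `v` modulo `W i`. -/
theorem mem_expMonoid_transporter {v : V} (i : ℕ) {g : Module.End ℂ V} (hg : g ∈ expMonoid G)
    (hgv : g v - v ∈ W i) : g ∈ expMonoid (h.transporter v i) := by
  induction i with
  | zero =>
    have hle : G ≤ h.transporter v 0 := fun x hx =>
      h.mem_transporter.mpr ⟨hx, by rw [h.zero]; exact Submodule.mem_top⟩
    exact expMonoid_mono hle hg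
  | succ i ih =>
    obtain ⟨k, hk, x, hx, rfl⟩ := exists_eq_mul_exp
      (h.transporter_isStrictlyTriangular v i).isNilLieSubspace
      (h.transporter_antitone v (Nat.le_succ i)) (h.commutator_mem_transporter v i)
      (ih (h.antitone (Nat.le_succ i) hgv))
    -- The displacement of `v` lies in `W (i + 1)` and is congruent to `x v`, which puts `x` in the
    -- next transporter.
    refine mul_mem hk (exp_mem_expMonoid ⟨hx.1, ?_⟩)
    simpa using (W _).sub_mem hgv (h.mul_exp_apply_sub_mem hk hx)

end IsStrictlyTriangular

end Flag


/-! ### Polynomial maps between complex vector spaces. -/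

section PolynomialMap

/-- The polynomial functions on a complex vector space: the algebra generated by the linear
forms. -/
def polynomialFunctionAlgebra (V : Type*) [AddCommGroup V] [Module ℂ V] : Subalgebra ℂ (V → ℂ) :=
  Algebra.adjoin ℂ (Set.range fun φ : Module.Dual ℂ V => (φ : V → ℂ))

/-- A map between complex vector spaces is polynomial if its composite with every linear form is a
polynomial function. -/
def IsPolynomialMap {V M : Type*} [AddCommGroup V] [Module ℂ V] [AddCommGroup M] [Module ℂ M]
    (f : V → M) : Prop :=
  ∀ φ : Module.Dual ℂ M, (fun v => φ (f v)) ∈ polynomialFunctionAlgebra V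

namespace IsPolynomialMap

variable {V M N P : Type*} [AddCommGroup V] [Module ℂ V] [AddCommGroup M] [Module ℂ M]
  [AddCommGroup N] [Module ℂ N] [AddCommGroup P] [Module ℂ P]

theorem linear (f : V →ₗ[ℂ] M) : IsPolynomialMap f := fun φ =>
  Algebra.subset_adjoin ⟨φ ∘ₗ f, rfl⟩

theorem const (m : M) : IsPolynomialMap fun _ : V => m := fun φ =>
  (polynomialFunctionAlgebra V).algebraMap_mem (φ m)

theorem linear_comp (L : M →ₗ[ℂ] N) {f : V → M} (hf : IsPolynomialMap f) :
    IsPolynomialMap fun v => L (f v) := fun φ => hf (φ ∘ₗ L)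

theorem add {f g : V → M} (hf : IsPolynomialMap f) (hg : IsPolynomialMap g) :
    IsPolynomialMap fun v => f v + g v := fun φ => by
  simpa only [map_add] using! (polynomialFunctionAlgebra V).add_mem (hf φ) (hg φ)

theorem sub {f g : V → M} (hf : IsPolynomialMap f) (hg : IsPolynomialMap g) :
    IsPolynomialMap fun v => f v - g v := fun φ => by
  simpa only [map_sub] using! (polynomialFunctionAlgebra V).sub_mem (hf φ) (hg φ)

theorem sum {ι : Type*} (s : Finset ι) {f : ι → V → M} (hf : ∀ i ∈ s, IsPolynomialMap (f i)) :
    IsPolynomialMap fun v => ∑ i ∈ s, f i v := fun φ => by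
  have := (polynomialFunctionAlgebra V).sum_mem fun i hi => hf i hi φ
  convert! this using 1
  ext v
  simp

theorem bilinear [FiniteDimensional ℂ M] [FiniteDimensional ℂ N] (B : M →ₗ[ℂ] N →ₗ[ℂ] P)
    {f : V → M} {g : V → N} (hf : IsPolynomialMap f) (hg : IsPolynomialMap g) :
    IsPolynomialMap fun v => B (f v) (g v) := fun φ => by
  let b := Module.finBasis ℂ M
  let c := Module.finBasis ℂ N
  have e : (fun v => φ (B (f v) (g v)))
      = ∑ i, ∑ j, ((fun v => b.coord i (f v)) * fun v => c.coord j (g v))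
          * algebraMap ℂ (V → ℂ) (φ (B (b i) (c j))) := by
    ext v
    conv_lhs => rw [← b.sum_repr (f v), ← c.sum_repr (g v)]
    simp only [map_sum, LinearMap.sum_apply, map_smul, LinearMap.smul_apply, smul_eq_mul,
      Finset.sum_apply, Pi.mul_apply, Pi.algebraMap_apply, Algebra.algebraMap_self_apply,
      Module.Basis.coord_apply, mul_assoc, Finset.mul_sum]
    rw [Finset.sum_comm]
    exact Finset.sum_congr rfl fun i _ => Finset.sum_congr rfl fun j _ => mul_left_comm _ _ _
  rw [e]
  exact Subalgebra.sum_mem _ fun i _ => Subalgebra.sum_mem _ fun j _ =>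
    Subalgebra.mul_mem _ (Subalgebra.mul_mem _ (hf _) (hg _)) (Subalgebra.algebraMap_mem _ _)

theorem mul {R : Type*} [Ring R] [Algebra ℂ R] [FiniteDimensional ℂ R] {f g : V → R}
    (hf : IsPolynomialMap f) (hg : IsPolynomialMap g) : IsPolynomialMap fun v => f v * g v :=
  bilinear (LinearMap.mul ℂ R) hf hg

theorem pow {R : Type*} [Ring R] [Algebra ℂ R] [FiniteDimensional ℂ R] {f : V → R}
    (hf : IsPolynomialMap f) (k : ℕ) : IsPolynomialMap fun v => f v ^ k := by
  induction k with
  | zero => simpa using const 1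
  | succ k ih => simpa only [pow_succ] using ih.mul hf

theorem apply [FiniteDimensional ℂ M] {f : V → Module.End ℂ M} {g : V → M}
    (hf : IsPolynomialMap f) (hg : IsPolynomialMap g) : IsPolynomialMap fun v => f v (g v) :=
  bilinear (LinearMap.id : Module.End ℂ M →ₗ[ℂ] Module.End ℂ M) hf hg

/-- A nilpotency bound `k` uniform in `v` makes the exponential one fixed polynomial. -/
theorem exp {R : Type*} [Ring R] [Algebra ℂ R] [FiniteDimensional ℂ R] [Module ℚ R] {f : V → R}
    (hf : IsPolynomialMap f) {k : ℕ} (hk : ∀ v, f v ^ k = 0) :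
    IsPolynomialMap fun v => IsNilpotent.exp (f v) := by
  have e : (fun v => IsNilpotent.exp (f v))
      = fun v => ∑ i ∈ Finset.range k, ((i.factorial : ℚ)⁻¹ : ℂ) • f v ^ i := by
    ext v
    rw [IsNilpotent.exp_eq_sum (hk v)]
    exact Finset.sum_congr rfl fun i _ => by rw [← Rat.cast_smul_eq_qsmul ℂ]; simp
  rw [e]
  exact sum _ fun i _ => linear_comp (LinearMap.lsmul ℂ R _) (hf.pow i)

end IsPolynomialMap

end PolynomialMap

/-! ### Closed orbits and stabilizers of unipotent groups. -/

namespace IsStrictlyTriangular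

variable {V : Type*} [AddCommGroup V] [Module ℂ V] [FiniteDimensional ℂ V]
  [Module ℚ (Module.End ℂ V)] {W : ℕ → Submodule ℂ V} {G : Submodule ℂ (Module.End ℂ V)}
  (h : IsStrictlyTriangular W G)

include h

/-- A polynomial cross section, modulo `W i`, of the orbit map `g ↦ g v` of `exp G`. -/
theorem exists_polynomial_section (v : V) (i : ℕ) :
    ∃ s t : V → Module.End ℂ V, IsPolynomialMap s ∧ IsPolynomialMap t ∧
      (∀ u, s u ∈ expMonoid G) ∧ (∀ u, t u ∈ expMonoid G) ∧ (∀ u, s u * t u = 1) ∧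
      (∀ u, t u * s u = 1) ∧
      ∀ g ∈ expMonoid G, s (g v) v - g v ∈ W i := by
  induction i with
  | zero =>
    exact ⟨fun _ => 1, fun _ => 1, .const 1, .const 1, fun _ => one_mem _, fun _ => one_mem _,
      fun _ => one_mul 1, fun _ => one_mul 1, fun g _ => by simp [h.zero]⟩
  | succ i ih =>
    obtain ⟨s, t, hs, ht, hsG, htG, hst, hts, hsec⟩ := ih
    obtain ⟨N, hN⟩ := h.exists_pow_eq_zero
    set T := h.transporter v i with hT
    let χ : T →ₗ[ℂ] V ⧸ W (i + 1) := (W (i + 1)).mkQ ∘ₗ LinearMap.applyₗ v ∘ₗ T.subtype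
    obtain ⟨τ, hτ⟩ := χ.rangeRestrict.exists_rightInverse_of_surjective χ.range_rangeRestrict
    obtain ⟨ρ, hρ⟩ := τ.exists_extend
    -- A linear choice of an element of `T` with prescribed displacement of `v` modulo `W (i + 1)`,
    -- whenever that displacement is attained.
    let σ : V →ₗ[ℂ] Module.End ℂ V := T.subtype ∘ₗ ρ ∘ₗ (W (i + 1)).mkQ
    have hσT : ∀ w, σ w ∈ T := fun w => (ρ ((W (i + 1)).mkQ w)).2
    have hσ : ∀ w, ∀ x ∈ T, w - x v ∈ W (i + 1) → σ w v - x v ∈ W (i + 1) := by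
      intro w x hx hw
      have e1 : (W (i + 1)).mkQ w = χ ⟨x, hx⟩ := (Submodule.Quotient.eq _).mpr hw
      have e2 : χ (ρ (χ ⟨x, hx⟩)) = χ ⟨x, hx⟩ := by
        have h1 : ρ (χ ⟨x, hx⟩) = τ (χ.rangeRestrict ⟨x, hx⟩) :=
          LinearMap.congr_fun hρ (χ.rangeRestrict ⟨x, hx⟩)
        have h2 := LinearMap.congr_fun hτ (χ.rangeRestrict ⟨x, hx⟩)
        rw [h1]
        exact congrArg Subtype.val h2
      refine (Submodule.Quotient.eq _).mp ?_
      change χ (ρ ((W (i + 1)).mkQ w)) = χ ⟨x, hx⟩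
      rw [e1, e2]
    -- On the orbit `t u` brings `u` back to `v` modulo `W i`; `exp (c u)` corrects the remaining
    -- error modulo `W (i + 1)`. The inverse `t` is carried along so that the correction is
    -- polynomial in `u`.
    let c : V → Module.End ℂ V := fun u => σ (t u u - v)
    have hc : IsPolynomialMap c :=
      ((ht.apply (.linear LinearMap.id)).sub (.const v)).linear_comp σ
    have hcT : ∀ u, c u ∈ T := fun u => hσT _
    have hcn : ∀ u, IsNilpotent (c u) := fun u => h.isNilpotent (hcT u).1
    refine ⟨fun u => s u * IsNilpotent.exp (c u), fun u => IsNilpotent.exp (-(c u)) * t u,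
      hs.mul (hc.exp fun u => hN _ (hcT u).1),
      ((hc.linear_comp (-LinearMap.id)).exp fun u => hN _ (G.neg_mem (hcT u).1)).mul ht,
      fun u => mul_mem (hsG u) (exp_mem_expMonoid (hcT u).1),
      fun u => mul_mem (exp_mem_expMonoid (G.neg_mem (hcT u).1)) (htG u), fun u => ?_, fun u => ?_,
      fun g hg => ?_⟩
    · rw [mul_assoc, ← mul_assoc (IsNilpotent.exp _) _ (t u),
        IsNilpotent.exp_mul_exp_neg_self (hcn u), one_mul, hst]
    · rw [mul_assoc, ← mul_assoc (t u), hts, one_mul, IsNilpotent.exp_neg_mul_exp_self (hcn u)]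
    · set u := g v with hu
      have htu : (t u * g) v - v ∈ W i := by
        have h1 := h.expMonoid_apply_mem (htG u) ((W i).neg_mem (hsec g hg))
        rw [neg_sub, map_sub, ← Module.End.mul_apply (t u) (s u), hts] at h1
        exact h1
      have hmem := h.mem_expMonoid_transporter i (mul_mem (htG u) hg) htu
      -- The factorization shows that the displacement `t u u - v` is attained by some `x ∈ T`, as
      -- `hσ` requires.
      obtain ⟨k, hk, x, hx, hkx⟩ := exists_eq_mul_exp
        (h.transporter_isStrictlyTriangular v i).isNilLieSubspace
        (h.transporter_antitone v (Nat.le_succ i)) (h.commutator_mem_transporter v i) hmem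
      have h1 := h.mul_exp_apply_sub_mem hk hx
      rw [← hkx] at h1
      have h2 := hσ (t u u - v) x hx h1
      have h3 := h.exp_apply_sub_mem (hcT u).1 (hcT u).2
      have h4 : IsNilpotent.exp (c u) v - t u u ∈ W (i + 1) := by
        have := (W _).sub_mem ((W _).add_mem h3 h2) h1
        convert! this using 1
        simp only [c, Module.End.mul_apply, ← hu]
        abel
      have h5 := h.expMonoid_apply_mem (hsG u) h4
      rw [map_sub, ← Module.End.mul_apply (s u) (t u), hst] at h5
      exact h5

/-- Orbits of unipotent groups are closed: a point at which all polynomial functions vanishing on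
the orbit of `v` vanish lies in the orbit. -/
theorem mem_orbit_of_forall_polynomial (v u : V)
    (hu : ∀ f ∈ polynomialFunctionAlgebra V, (∀ g ∈ expMonoid G, f (g v) = 0) → f u = 0) :
    ∃ g ∈ expMonoid G, g v = u := by
  obtain ⟨N, hN⟩ := h.exists_eq_bot
  obtain ⟨s, t, hs, -, hsG, -, -, -, hsec⟩ := h.exists_polynomial_section v N
  refine ⟨s u, hsG u, sub_eq_zero.mp ((Module.forall_dual_apply_eq_zero_iff ℂ _).mp fun φ => ?_)⟩
  -- With `W N = ⊥` the section is exact on the orbit, so the coordinates of `s u v - u` are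
  -- polynomials vanishing there.
  refine hu _ (((hs.apply (.const v)).sub (.linear LinearMap.id)) φ) fun g hg => ?_
  have := hsec g hg
  rw [hN, Submodule.mem_bot] at this
  simp only [LinearMap.id_apply, this, map_zero]

/-- The stabilizer of `v` in `exp G` is generated by the exponentials of the elements of `G` that
kill `v`. -/
theorem mem_expMonoid_of_apply_eq {v : V} {g : Module.End ℂ V} (hg : g ∈ expMonoid G)
    (hgv : g v = v) : g ∈ expMonoid (G ⊓ LinearMap.ker (LinearMap.applyₗ v)) := by
  obtain ⟨N, hN⟩ := h.exists_eq_bot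
  have := h.mem_expMonoid_transporter N hg (v := v) (by simp [hgv])
  have hle : h.transporter v N ≤ G ⊓ LinearMap.ker (LinearMap.applyₗ v) := fun x hx =>
    ⟨hx.1, by simpa [hN] using (h.mem_transporter.mp hx).2⟩
  exact expMonoid_mono hle this

end IsStrictlyTriangular


open scoped Matrix.Norms.Operator in
theorem IsNilpotent.hasDerivAt_linear_exp_smul {R : Type*} [Ring R] [Algebra ℂ R]
    [FiniteDimensional ℂ R] [Module ℚ R] {x : R} (hx : IsNilpotent x) (φ : R →ₗ[ℂ] ℂ) (z : ℂ) :
    HasDerivAt (fun w : ℂ => φ (IsNilpotent.exp (w • x))) (φ (x * IsNilpotent.exp (z • x))) z := by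
  let b := Module.finBasis ℂ R
  let f : R →ₐ[ℂ] Matrix (Fin (Module.finrank ℂ R)) (Fin (Module.finrank ℂ R)) ℂ :=
    (LinearMap.toMatrixAlgEquiv b).toAlgHom.comp (Algebra.lmul ℂ R)
  have hf : Function.Injective f :=
    (LinearMap.toMatrixAlgEquiv b).injective.comp Algebra.lmul_injective
  let _ : NormedRing R := NormedRing.induced R _ f hf
  let _ : NormedAlgebra ℂ R := NormedAlgebra.induced ℂ R _ f
  have : CompleteSpace R := FiniteDimensional.complete ℂ R
  have h := IsNilpotent.hasDerivAt_exp_smul hx z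
  exact (LinearMap.toContinuousLinearMap φ).hasFDerivAt.comp_hasDerivAt z h

/-! ### Primitive Poisson ideals as vanishing ideals of orbits. -/

namespace SocleLie

namespace SocleExhaustion

universe u

variable {n : Type u} [LieRing n] [LieAlgebra ℂ n] (E : SocleExhaustion n)

instance (k : ℕ) : FiniteDimensional ℂ (E.ideal k) := E.finiteDimensional k

theorem coad_smul (k : ℕ) (c : ℂ) (x : n) : E.coad k (c • x) = c • E.coad k x :=
  map_smul (LieModule.toEnd ℂ n (Module.Dual ℂ (E.ideal k))) c x

theorem restrict_coad {k l : ℕ} (h : k ≤ l) (x : n) :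
    E.restrict h ∘ₗ E.coad l x = E.coad k x ∘ₗ E.restrict h := rfl

theorem restrict_coadExp {k l : ℕ} (h : k ≤ l) (x : n) (f : Module.Dual ℂ (E.ideal l)) :
    E.restrict h ((E.coadExp l x).val f) = (E.coadExp k x).val (E.restrict h f) := by
  rw [coe_coadExp, coe_coadExp]
  exact LinearMap.congr_fun (Module.End.commute_exp_left_of_commute (E.isNilpotent_coad l x)
    (E.isNilpotent_coad k x) (E.restrict_coad h x).symm).symm f

theorem coadExp_mem_proGroupLevel (k : ℕ) (x : n) : E.coadExp k x ∈ E.proGroupLevel k := by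
  obtain ⟨l, hl⟩ := E.exhausts x
  exact (E.mem_proGroupLevel k _).mpr ⟨max k l, le_max_left _ _,
    Subgroup.subset_closure ⟨x, E.mono (le_max_right k l) hl, rfl⟩⟩

theorem proGroupLevel_eq_closure (k : ℕ) :
    E.proGroupLevel k = Subgroup.closure (Set.range (E.coadExp k)) := by
  apply le_antisymm
  · intro g hg
    obtain ⟨l, -, hl⟩ := (E.mem_proGroupLevel k g).mp hg
    exact Subgroup.closure_mono (Set.image_subset_range _ _) hl
  · rw [Subgroup.closure_le]
    rintro - ⟨x, rfl⟩
    exact E.coadExp_mem_proGroupLevel k x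

/-- The element `exp x` of the pro-group. -/
def expElement (x : n) : E.proGroup :=
  ⟨fun k => E.coadExp k x, fun k => E.coadExp_mem_proGroupLevel k x,
    fun _ _ h f => E.restrict_coadExp h x f⟩

theorem smul_apply (g : E.proGroup) (lam : Module.Dual ℂ n) {k : ℕ} {y : n} (hy : y ∈ E.ideal k) :
    (g • lam) y = (g.1 k).val (E.restrictTo k lam) ⟨y, hy⟩ :=
  LinearMap.congr_fun (E.restrictTo_act g lam k) ⟨y, hy⟩

theorem expElement_zero : E.expElement 0 = 1 := by
  refine Subtype.ext (funext fun k => Units.ext ?_)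
  change IsNilpotent.exp (E.coad k 0) = 1
  rw [show E.coad k 0 = 0 from map_zero (LieModule.toEnd ℂ n (Module.Dual ℂ (E.ideal k))),
    IsNilpotent.exp_zero]

/-- The flow of `x` on functions is generated by `-{x, ·}`, the sign being that of the coadjoint
action. It is checked on linear forms and extended by the Leibniz rule. -/
theorem hasDerivAt_eval_expElement (x : n) (lam : Module.Dual ℂ n) (f : SymmetricAlgebra ℂ n)
    (z : ℂ) :
    HasDerivAt (fun t : ℂ => SymmetricAlgebra.lift (E.expElement (t • x) • lam) f)
      (-SymmetricAlgebra.lift (E.expElement (z • x) • lam) (bracketLeft x f)) z := by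
  induction f using SymmetricAlgebra.induction with
  | algebraMap r => simpa using hasDerivAt_const z r
  | ι y =>
    obtain ⟨k, hk⟩ := E.exhausts y
    have e : ∀ t : ℂ, ∀ w (hw : w ∈ E.ideal k), (E.expElement (t • x) • lam) w
        = IsNilpotent.exp (t • E.coad k x) (E.restrictTo k lam) ⟨w, hw⟩ := fun t w hw => by
      rw [E.smul_apply _ _ hw, ← E.coad_smul]
      rfl
    have hxy : ⁅x, y⁆ ∈ E.ideal k := (E.ideal k).lie_mem hk
    let φ : Module.End ℂ (Module.Dual ℂ (E.ideal k)) →ₗ[ℂ] ℂ :=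
      LinearMap.applyₗ (⟨y, hk⟩ : E.ideal k) ∘ₗ LinearMap.applyₗ (E.restrictTo k lam)
    have h := IsNilpotent.hasDerivAt_linear_exp_smul (E.isNilpotent_coad k x) φ z
    simp only [SymmetricAlgebra.lift_ι_apply, bracketLeft, derivationOf_ι, LinearMap.comp_apply,
      LieAlgebra.ad_apply, e _ y hk, e _ _ hxy]
    exact h
  | mul a b ha hb =>
    have := ha.mul hb
    simp only [map_mul, Derivation.leibniz, map_add, smul_eq_mul]
    convert! this using 1
    ring
  | add a b ha hb =>
    have := ha.add hb
    simp only [map_add, neg_add]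
    exact this

theorem bracketLeft_mem {I : Ideal (SymmetricAlgebra ℂ n)} (hI : IsPoissonIdeal I) (x : n)
    {f : SymmetricAlgebra ℂ n} (hf : f ∈ I) : bracketLeft x f ∈ I := by
  rw [← poissonBracket_ι_left]
  exact hI _ f hf

theorem isPoissonIdeal_of_bracketLeft {I : Ideal (SymmetricAlgebra ℂ n)}
    (hI : ∀ x, ∀ f ∈ I, bracketLeft x f ∈ I) : IsPoissonIdeal I := by
  intro f g hg
  induction f using SymmetricAlgebra.induction with
  | algebraMap r => rw [poissonBracket_algebraMap_left]; exact I.zero_mem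
  | ι x => rw [poissonBracket_ι_left]; exact hI x g hg
  | mul a b ha hb =>
    rw [poissonBracket_mul_left]
    exact I.add_mem (I.mul_mem_left _ hb) (I.mul_mem_left _ ha)
  | add a b ha hb => rw [poissonBracket_add_left]; exact I.add_mem ha hb

/-- All Taylor coefficients at `0` of `t ↦ f(exp(tx).lam)` vanish, since `I` is stable under `{x,
·}`; the function is entire, so its value at `1` vanishes. -/
theorem le_evalIdeal_expElement {I : Ideal (SymmetricAlgebra ℂ n)} (hI : IsPoissonIdeal I)
    {lam : Module.Dual ℂ n} (h : I ≤ evalIdeal lam) (x : n) :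
    I ≤ evalIdeal (E.expElement x • lam) := by
  intro f hf
  let F : SymmetricAlgebra ℂ n → ℂ → ℂ := fun f t =>
    SymmetricAlgebra.lift (E.expElement (t • x) • lam) f
  have hd : ∀ f z, HasDerivAt (F f) (-F (bracketLeft x f) z) z :=
    E.hasDerivAt_eval_expElement x lam
  have hzero : ∀ i, ∀ f ∈ I, iteratedDeriv i (F f) 0 = 0 := by
    intro i
    induction i with
    | zero =>
      intro f hf
      have := h hf
      simpa [F, expElement_zero, evalIdeal] using this
    | succ i ih =>
      intro f hf
      have : deriv (F f) = -F (bracketLeft x f) := funext fun z => (hd f z).deriv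
      rw [iteratedDeriv_succ', this, iteratedDeriv_neg, ih _ (bracketLeft_mem hI x hf), neg_zero]
  have := Complex.taylorSeries_eq_of_entire' (c := 0) (z := 1)
    (f := F f) fun z => (hd f z).differentiableAt
  simp only [hzero _ f hf, mul_zero, zero_mul, tsum_zero] at this
  change SymmetricAlgebra.lift (E.expElement x • lam) f = 0
  rw [this]
  simp [F]

/-- The ideal of functions vanishing on the orbit of `lam` under the pro-group. -/
def orbitIdeal (lam : Module.Dual ℂ n) : Ideal (SymmetricAlgebra ℂ n) :=
  ⨅ g : E.proGroup, evalIdeal (g • lam)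

theorem mem_orbitIdeal {lam : Module.Dual ℂ n} {f : SymmetricAlgebra ℂ n} :
    f ∈ E.orbitIdeal lam ↔ ∀ g : E.proGroup, SymmetricAlgebra.lift (g • lam) f = 0 := by
  simp [orbitIdeal, Submodule.mem_iInf, evalIdeal]

/-- For `f` vanishing on the orbit, the zero function `t ↦ f(exp(tx).g.lam)` has derivative `-{x,
f}(g.lam)` at `0`. -/
theorem isPoissonIdeal_orbitIdeal (lam : Module.Dual ℂ n) : IsPoissonIdeal (E.orbitIdeal lam) := by
  refine isPoissonIdeal_of_bracketLeft fun x f hf => E.mem_orbitIdeal.mpr fun g => ?_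
  have h := E.hasDerivAt_eval_expElement x (g • lam) f 0
  have hF : (fun t : ℂ => SymmetricAlgebra.lift (E.expElement (t • x) • g • lam) f) = fun _ => 0 :=
    funext fun t => by
      rw [← mul_smul]
      exact E.mem_orbitIdeal.mp hf _
  rw [hF] at h
  have := h.unique (hasDerivAt_const 0 0)
  simpa [expElement_zero] using this

/-- The homomorphism `S(n_k) → S(n)`. -/
def symmetricMap (k : ℕ) : SymmetricAlgebra ℂ (E.ideal k) →ₐ[ℂ] SymmetricAlgebra ℂ n :=
  SymmetricAlgebra.lift (SymmetricAlgebra.ι ℂ n ∘ₗ (E.ideal k).toSubmodule.subtype)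

theorem lift_symmetricMap (k : ℕ) (lam : Module.Dual ℂ n) (f : SymmetricAlgebra ℂ (E.ideal k)) :
    SymmetricAlgebra.lift lam (E.symmetricMap k f)
      = SymmetricAlgebra.lift (E.restrictTo k lam) f := by
  have : (SymmetricAlgebra.lift lam).comp (E.symmetricMap k)
      = SymmetricAlgebra.lift (E.restrictTo k lam) := by
    apply SymmetricAlgebra.algHom_ext
    ext y
    simp [symmetricMap, restrictTo]
  exact congrArg (fun G : SymmetricAlgebra ℂ (E.ideal k) →ₐ[ℂ] ℂ => G f) this

theorem symmetricMap_range_mono : Monotone fun k => (E.symmetricMap k).range := by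
  intro k l h
  rintro - ⟨f, rfl⟩
  induction f using SymmetricAlgebra.induction with
  | algebraMap r => exact ⟨algebraMap _ _ r, by simp⟩
  | ι y => exact ⟨SymmetricAlgebra.ι ℂ _ ⟨y, E.mono h y.2⟩, by simp [symmetricMap]; rfl⟩
  | mul a b ha hb =>
    simp only [map_mul] at ha hb ⊢
    exact mul_mem ha hb
  | add a b ha hb =>
    simp only [map_add] at ha hb ⊢
    exact add_mem ha hb

theorem exists_symmetricMap_eq (f : SymmetricAlgebra ℂ n) : ∃ k, f ∈ (E.symmetricMap k).range := by
  induction f using SymmetricAlgebra.induction with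
  | algebraMap r => exact ⟨0, algebraMap _ _ r, by simp⟩
  | ι y =>
    obtain ⟨k, hk⟩ := E.exhausts y
    exact ⟨k, SymmetricAlgebra.ι ℂ _ ⟨y, hk⟩, by simp [symmetricMap]; rfl⟩
  | mul a b ha hb =>
    obtain ⟨k, hk⟩ := ha
    obtain ⟨l, hl⟩ := hb
    exact ⟨max k l, mul_mem (E.symmetricMap_range_mono (le_max_left k l) hk)
      (E.symmetricMap_range_mono (le_max_right k l) hl)⟩
  | add a b ha hb =>
    obtain ⟨k, hk⟩ := ha
    obtain ⟨l, hl⟩ := hb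
    exact ⟨max k l, add_mem (E.symmetricMap_range_mono (le_max_left k l) hk)
      (E.symmetricMap_range_mono (le_max_right k l) hl)⟩

/-- The subgroup of the pro-group generated by the exponentials of elements of a subspace. -/
def expSubgroup (S : Submodule ℂ n) : Subgroup E.proGroup :=
  Subgroup.closure (E.expElement '' (S : Set n))

/-- Exponentials live at all levels at once; therefore at any single level an element of the
pro-group may be replaced by a product of exponentials. -/
theorem exists_mem_expSubgroup (k : ℕ)
    {g : LinearMap.GeneralLinearGroup ℂ (Module.Dual ℂ (E.ideal k))} (hg : g ∈ E.proGroupLevel k) :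
    ∃ g' ∈ E.expSubgroup ⊤, g'.1 k = g := by
  let p : E.proGroup →* LinearMap.GeneralLinearGroup ℂ (Module.Dual ℂ (E.ideal k)) :=
    (Pi.evalMonoidHom _ k).comp E.proGroup.subtype
  have : E.proGroupLevel k = (E.expSubgroup ⊤).map p := by
    rw [proGroupLevel_eq_closure, expSubgroup, MonoidHom.map_closure, Submodule.top_coe,
      Set.image_univ, ← Set.range_comp]
    rfl
  rw [this] at hg
  exact hg

theorem expElement_inv (x : n) : (E.expElement x)⁻¹ = E.expElement (-x) := by
  rw [inv_eq_iff_mul_eq_one]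
  refine Subtype.ext (funext fun k => Units.ext ?_)
  change IsNilpotent.exp (E.coad k x) * IsNilpotent.exp (E.coad k (-x)) = 1
  rw [show E.coad k (-x) = -E.coad k x from
    map_neg (LieModule.toEnd ℂ n (Module.Dual ℂ (E.ideal k))) x]
  exact IsNilpotent.exp_mul_exp_neg_self (E.isNilpotent_coad k x)

theorem le_evalIdeal_smul {I : Ideal (SymmetricAlgebra ℂ n)} (hI : IsPoissonIdeal I)
    {lam : Module.Dual ℂ n} (h : I ≤ evalIdeal lam) {g : E.proGroup} (hg : g ∈ E.expSubgroup ⊤) :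
    I ≤ evalIdeal (g • lam) := by
  induction hg using Subgroup.closure_induction'' generalizing lam with
  | mem g hg =>
    obtain ⟨x, -, rfl⟩ := hg
    exact E.le_evalIdeal_expElement hI h x
  | inv_mem g hg =>
    obtain ⟨x, -, rfl⟩ := hg
    rw [expElement_inv]
    exact E.le_evalIdeal_expElement hI h (-x)
  | one => rwa [one_smul]
  | mul a b _ _ ha hb => rw [mul_smul]; exact ha (hb h)

/-- The primitive Poisson ideal of `lam` is the vanishing ideal of the orbit of `lam`. -/
theorem primitiveIdeal_eq_orbitIdeal (lam : Module.Dual ℂ n) :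
    primitiveIdeal lam = E.orbitIdeal lam := by
  apply le_antisymm
  · intro f hf
    refine E.mem_orbitIdeal.mpr fun g => ?_
    -- As `f` involves only `n_k`, its value at `g • lam` depends only on the component `g_k`.
    obtain ⟨k, f, rfl⟩ := E.exists_symmetricMap_eq f
    obtain ⟨g', hg', hk⟩ := E.exists_mem_expSubgroup k (g.2.1 k)
    have h := isGreatest_primitiveIdeal lam
    have h1 : SymmetricAlgebra.lift (g' • lam) (E.symmetricMap k f) = 0 :=
      E.le_evalIdeal_smul h.1.1 h.1.2 hg' hf
    have h2 : E.restrictTo k (g • lam) = E.restrictTo k (g' • lam) :=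
      (E.restrictTo_act g lam k).trans (by rw [← hk]; exact (E.restrictTo_act g' lam k).symm)
    change SymmetricAlgebra.lift (g • lam) (E.symmetricMap k f) = 0
    rw [lift_symmetricMap, h2, ← lift_symmetricMap, h1]
  · refine (isGreatest_primitiveIdeal lam).2 ⟨E.isPoissonIdeal_orbitIdeal lam, ?_⟩
    intro f hf
    have := E.mem_orbitIdeal.mp hf 1
    rwa [one_smul] at this

end SocleExhaustion

end SocleLie


/-! ### Triangularity from Engel's theorem; polynomial functions as elements of the symmetric
algebra. -/

theorem LieModule.isStrictlyTriangular_range_toEnd (L M : Type*) [LieRing L] [LieAlgebra ℂ L]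
    [AddCommGroup M] [Module ℂ M] [LieRingModule L M] [LieModule ℂ L M] [FiniteDimensional ℂ M]
    (h : ∀ x : L, _root_.IsNilpotent (LieModule.toEnd ℂ L M x)) :
    IsStrictlyTriangular (fun i => (LieModule.lowerCentralSeries ℂ L M i).toSubmodule)
      (LinearMap.range (LieModule.toEnd ℂ L M : L →ₗ[ℂ] Module.End ℂ M)) where
  antitone _ _ hij := LieModule.antitone_lowerCentralSeries ℂ L M hij
  zero := by simp
  exists_eq_bot := by
    obtain ⟨k, hk⟩ := (LieModule.isNilpotent_iff ℂ L M).mp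
      ((LieModule.isNilpotent_iff_forall' (R := ℂ)).mpr h)
    exact ⟨k, by simp [hk]⟩
  commutator_mem := by
    rintro - ⟨x, rfl⟩ - ⟨y, rfl⟩
    exact ⟨⁅x, y⁆, LinearMap.ext fun m => lie_lie x y m⟩
  apply_mem := by
    rintro - ⟨x, rfl⟩ i w hw
    rw [LieModule.lowerCentralSeries_succ]
    exact LieSubmodule.lie_mem_lie (LieSubmodule.mem_top x) hw

theorem exists_lift_of_mem_polynomialFunctionAlgebra {M : Type*} [AddCommGroup M] [Module ℂ M]
    [FiniteDimensional ℂ M] {f : Module.Dual ℂ M → ℂ}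
    (hf : f ∈ polynomialFunctionAlgebra (Module.Dual ℂ M)) :
    ∃ F : SymmetricAlgebra ℂ M, ∀ ν, f ν = SymmetricAlgebra.lift ν F := by
  induction hf using Algebra.adjoin_induction with
  | mem f hf =>
    obtain ⟨φ, rfl⟩ := hf
    obtain ⟨y, rfl⟩ := (Module.evalEquiv ℂ M).surjective φ
    exact ⟨SymmetricAlgebra.ι ℂ M y, fun ν => by simp⟩
  | algebraMap r => exact ⟨algebraMap _ _ r, fun ν => by simp⟩
  | add f g _ _ hf hg =>
    obtain ⟨F, hF⟩ := hf
    obtain ⟨G, hG⟩ := hg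
    exact ⟨F + G, fun ν => by simp [hF, hG]⟩
  | mul f g _ _ hf hg =>
    obtain ⟨F, hF⟩ := hf
    obtain ⟨G, hG⟩ := hg
    exact ⟨F * G, fun ν => by simp [hF, hG]⟩

/-! ### Conjugacy at each level and the Mittag-Leffler argument. -/

namespace SocleLie

namespace SocleExhaustion

universe u

variable {n : Type u} [LieRing n] [LieAlgebra ℂ n] (E : SocleExhaustion n)

/-- The coadjoint action on `n_k^*` as a linear map. -/
def coadLinear (k : ℕ) : n →ₗ[ℂ] Module.End ℂ (Module.Dual ℂ (E.ideal k)) :=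
  (LieModule.toEnd ℂ n (Module.Dual ℂ (E.ideal k)) : n →ₗ[ℂ] _)

theorem isStrictlyTriangular_range_coadLinear (k : ℕ) :
    IsStrictlyTriangular
      (fun i => (LieModule.lowerCentralSeries ℂ n (Module.Dual ℂ (E.ideal k)) i).toSubmodule)
      (LinearMap.range (E.coadLinear k)) :=
  LieModule.isStrictlyTriangular_range_toEnd n _ (E.isNilpotent_coad k)

/-- Dictionary between the pro-group and the operators on `n_k^*`; a monoid suffices there because
`exp(-x)` inverts `exp x`. -/
theorem mem_expMonoid_map_iff (k : ℕ) (S : Submodule ℂ n)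
    (a : Module.End ℂ (Module.Dual ℂ (E.ideal k))) :
    a ∈ expMonoid (S.map (E.coadLinear k)) ↔ ∃ g ∈ E.expSubgroup S, (g.1 k).val = a := by
  constructor
  · intro ha
    induction ha using Submonoid.closure_induction with
    | mem a ha =>
      obtain ⟨-, ⟨x, hx, rfl⟩, rfl⟩ := ha
      exact ⟨E.expElement x, Subgroup.subset_closure ⟨x, hx, rfl⟩, rfl⟩
    | one => exact ⟨1, one_mem _, rfl⟩
    | mul a b _ _ ha hb =>
      obtain ⟨g, hg, rfl⟩ := ha
      obtain ⟨g', hg', rfl⟩ := hb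
      exact ⟨g * g', mul_mem hg hg', rfl⟩
  · rintro ⟨g, hg, rfl⟩
    induction hg using Subgroup.closure_induction'' with
    | mem g hg =>
      obtain ⟨x, hx, rfl⟩ := hg
      exact exp_mem_expMonoid ⟨x, hx, rfl⟩
    | inv_mem g hg =>
      obtain ⟨x, hx, rfl⟩ := hg
      rw [expElement_inv]
      exact exp_mem_expMonoid ⟨-x, S.neg_mem hx, rfl⟩
    | one => exact one_mem _
    | mul a b _ _ ha hb => exact mul_mem ha hb

theorem mem_expMonoid_range_iff (k : ℕ) (a : Module.End ℂ (Module.Dual ℂ (E.ideal k))) :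
    a ∈ expMonoid (LinearMap.range (E.coadLinear k)) ↔
      ∃ g ∈ E.expSubgroup ⊤, (g.1 k).val = a := by
  rw [LinearMap.range_eq_map]
  exact E.mem_expMonoid_map_iff k ⊤ a

theorem restrictTo_smul (g : E.proGroup) (lam : Module.Dual ℂ n) (k : ℕ) :
    E.restrictTo k (g • lam) = (g.1 k).val (E.restrictTo k lam) :=
  E.restrictTo_act g lam k

theorem restrictTo_smul_congr (g : E.proGroup) {lam mu : Module.Dual ℂ n} {k : ℕ}
    (h : E.restrictTo k lam = E.restrictTo k mu) :
    E.restrictTo k (g • lam) = E.restrictTo k (g • mu) := by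
  rw [restrictTo_smul, restrictTo_smul, h]

theorem restrictTo_eq_of_le {k l : ℕ} (hkl : k ≤ l) {lam mu : Module.Dual ℂ n}
    (h : E.restrictTo l lam = E.restrictTo l mu) : E.restrictTo k lam = E.restrictTo k mu := by
  rw [← E.restrict_restrictTo hkl, h, E.restrict_restrictTo]

theorem proGroup_apply_eq_of_le {k l : ℕ} (hkl : k ≤ l) {g g' : E.proGroup}
    (h : g.1 l = g'.1 l) : g.1 k = g'.1 k := by
  refine Units.ext (LinearMap.ext fun f => ?_)
  obtain ⟨f, rfl⟩ := LinearMap.dualMap_surjective_of_injective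
    (Submodule.inclusion_injective
      (show (E.ideal k).toSubmodule ≤ (E.ideal l).toSubmodule from E.mono hkl)) f
  have h1 := g.2.2 k l hkl f
  have h2 := g'.2.2 k l hkl f
  rw [h] at h1
  exact h1.symm.trans h2

/-- If the primitive ideals of `lam` and `mu` agree, then so do the orbits of their restrictions
to each member of the chain. -/
theorem exists_restrictTo_smul_eq {lam mu : Module.Dual ℂ n}
    (h : primitiveIdeal lam = primitiveIdeal mu) (k : ℕ) :
    ∃ g ∈ E.expSubgroup ⊤, E.restrictTo k (g • lam) = E.restrictTo k mu := by
  -- A polynomial vanishing on the orbit at level `k` is an element of `S(n_k)` whose image lies in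
  -- `I(lam) = I(mu)`, hence vanishes at `mu`.
  have hclosed : ∀ f ∈ polynomialFunctionAlgebra (Module.Dual ℂ (E.ideal k)),
      (∀ a ∈ expMonoid (LinearMap.range (E.coadLinear k)), f (a (E.restrictTo k lam)) = 0) →
        f (E.restrictTo k mu) = 0 := by
    intro f hf hzero
    obtain ⟨F, hF⟩ := exists_lift_of_mem_polynomialFunctionAlgebra hf
    have hmem : E.symmetricMap k F ∈ primitiveIdeal lam := by
      rw [E.primitiveIdeal_eq_orbitIdeal]
      refine E.mem_orbitIdeal.mpr fun g => ?_
      rw [lift_symmetricMap, restrictTo_smul, ← hF]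
      refine hzero _ ((E.mem_expMonoid_range_iff k _).mpr ?_)
      obtain ⟨g', hg', hk⟩ := E.exists_mem_expSubgroup k (g.2.1 k)
      exact ⟨g', hg', by rw [hk]⟩
    rw [h] at hmem
    have := (isGreatest_primitiveIdeal mu).1.2 hmem
    rw [hF, ← lift_symmetricMap]
    exact this
  obtain ⟨a, ha, hau⟩ := (E.isStrictlyTriangular_range_coadLinear k).mem_orbit_of_forall_polynomial
    (E.restrictTo k lam) (E.restrictTo k mu) hclosed
  obtain ⟨g, hg, rfl⟩ := (E.mem_expMonoid_range_iff k a).mp ha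
  exact ⟨g, hg, by rw [restrictTo_smul, hau]⟩

/-- The stabilizer in `n` of the restriction of `lam` to `n_l`. -/
def stabilizer (lam : Module.Dual ℂ n) (l : ℕ) : Submodule ℂ n :=
  LinearMap.ker (LinearMap.applyₗ (E.restrictTo l lam) ∘ₗ E.coadLinear l)

theorem mem_stabilizer {lam : Module.Dual ℂ n} {l : ℕ} {x : n} :
    x ∈ E.stabilizer lam l ↔ E.coad l x (E.restrictTo l lam) = 0 := Iff.rfl

theorem stabilizer_antitone (lam : Module.Dual ℂ n) : Antitone (E.stabilizer lam) := by
  intro k l h x hx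
  have h1 := LinearMap.congr_fun (E.restrict_coad h x) (E.restrictTo l lam)
  rw [LinearMap.comp_apply, E.mem_stabilizer.mp hx, map_zero] at h1
  exact h1.symm

theorem restrictTo_smul_of_mem_expSubgroup_stabilizer {lam : Module.Dual ℂ n} {l : ℕ}
    {g : E.proGroup} (hg : g ∈ E.expSubgroup (E.stabilizer lam l)) :
    E.restrictTo l (g • lam) = E.restrictTo l lam := by
  have hexp : ∀ x ∈ E.stabilizer lam l,
      E.restrictTo l (E.expElement x • lam) = E.restrictTo l lam := by
    intro x hx
    rw [restrictTo_smul]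
    change IsNilpotent.exp (E.coad l x) (E.restrictTo l lam) = _
    obtain ⟨k, hk⟩ := E.isNilpotent_coad l x
    rw [IsNilpotent.exp_eq_sum (pow_eq_zero_of_le (Nat.le_succ k) hk), Finset.sum_range_succ']
    simp only [← Rat.cast_smul_eq_qsmul ℂ, LinearMap.add_apply, LinearMap.sum_apply,
      LinearMap.smul_apply, pow_succ, Module.End.mul_apply, E.mem_stabilizer.mp hx]
    simp
  induction hg using Subgroup.closure_induction'' with
  | mem g hg =>
    obtain ⟨x, hx, rfl⟩ := hg
    exact hexp x hx
  | inv_mem g hg =>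
    obtain ⟨x, hx, rfl⟩ := hg
    rw [expElement_inv]
    exact hexp _ (Submodule.neg_mem _ hx)
  | one => rw [one_smul]
  | mul a b _ _ ha hb => rw [mul_smul, E.restrictTo_smul_congr a hb, ha]

theorem exists_mem_expSubgroup_stabilizer {lam : Module.Dual ℂ n} {l : ℕ} {g : E.proGroup}
    (hg : g ∈ E.expSubgroup ⊤) (hgl : E.restrictTo l (g • lam) = E.restrictTo l lam) :
    ∃ g' ∈ E.expSubgroup (E.stabilizer lam l), g'.1 l = g.1 l := by
  have h1 := (E.isStrictlyTriangular_range_coadLinear l).mem_expMonoid_of_apply_eq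
    ((E.mem_expMonoid_range_iff l _).mpr ⟨g, hg, rfl⟩) ((E.restrictTo_smul g lam l).symm.trans hgl)
  have hle : LinearMap.range (E.coadLinear l)
      ⊓ LinearMap.ker (LinearMap.applyₗ (E.restrictTo l lam))
      ≤ (E.stabilizer lam l).map (E.coadLinear l) := by
    rintro - ⟨⟨x, rfl⟩, hx⟩
    exact ⟨x, hx, rfl⟩
  obtain ⟨g', hg', h⟩ := (E.mem_expMonoid_map_iff l _ _).mp (expMonoid_mono hle h1)
  exact ⟨g', hg', Units.ext h⟩

/-- The Mittag-Leffler property of the stabilizers of the restrictions of `lam`. -/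
theorem exists_stabilizer_lift (lam : Module.Dual ℂ n) (k : ℕ) :
    ∃ m, ∀ l ≥ m, k ≤ l → ∀ l' ≥ m, ∀ g ∈ E.expSubgroup ⊤,
      E.restrictTo l (g • lam) = E.restrictTo l lam →
      ∃ b ∈ E.expSubgroup ⊤, E.restrictTo l' (b • lam) = E.restrictTo l' lam ∧ b.1 k = g.1 k := by
  -- The images in `End(n_k^*)` of the Lie stabilizers decrease with `l`; finite dimension makes
  -- them constant from some `m` on.
  let f : ℕ →o (Submodule ℂ (Module.End ℂ (Module.Dual ℂ (E.ideal k))))ᵒᵈ :=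
    ⟨fun l => OrderDual.toDual ((E.stabilizer lam l).map (E.coadLinear k)),
      fun _ _ h => Submodule.map_mono (E.stabilizer_antitone lam h)⟩
  obtain ⟨m, hm⟩ := IsArtinian.monotone_stabilizes f
  refine ⟨m, fun l hl hkl l' hl' g hg hgl => ?_⟩
  have hf : (E.stabilizer lam l).map (E.coadLinear k)
      = (E.stabilizer lam l').map (E.coadLinear k) := (hm l hl).symm.trans (hm l' hl')
  -- Replacing `g` by exponentials of the Lie stabilizer keeps its component at level `l`, hence at
  -- level `k ≤ l`; that component can then be rebuilt from the stabilizer at level `l'`.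
  obtain ⟨g', hg', hgg'⟩ := E.exists_mem_expSubgroup_stabilizer hg hgl
  have h1 := (E.mem_expMonoid_map_iff k _ _).mpr ⟨g', hg', rfl⟩
  rw [hf] at h1
  obtain ⟨b, hb, hbk⟩ := (E.mem_expMonoid_map_iff k _ _).mp h1
  refine ⟨b, Subgroup.closure_mono (Set.image_mono (Set.subset_univ _)) hb,
    E.restrictTo_smul_of_mem_expSubgroup_stabilizer hb, ?_⟩
  rw [← E.proGroup_apply_eq_of_le hkl hgg']
  exact Units.ext hbk

/-- A linear form all of whose restrictions are conjugate to those of `lam` is conjugate to `lam`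
under the pro-group. -/
theorem exists_smul_eq {lam mu : Module.Dual ℂ n}
    (h : ∀ k, ∃ g ∈ E.expSubgroup ⊤, E.restrictTo k (g • lam) = E.restrictTo k mu) :
    ∃ g : E.proGroup, g • lam = mu := by
  choose m₀ hm₀ using E.exists_stabilizer_lift lam
  -- Chosen to be increasing and to dominate both `k` and the threshold `m₀ k`.
  let m : ℕ → ℕ := fun k => k + ∑ i ∈ Finset.range (k + 1), m₀ i
  have hkm : ∀ k, k ≤ m k := fun k => Nat.le_add_right _ _
  have hm₀m : ∀ k, m₀ k ≤ m k := fun k =>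
    (Finset.single_le_sum (f := m₀) (fun _ _ => Nat.zero_le _)
      (Finset.self_mem_range_succ k)).trans (Nat.le_add_left _ _)
  have hmm : ∀ k, m k ≤ m (k + 1) := fun k => by
    simp only [m, Finset.sum_range_succ _ (k + 1)]
    omega
  let P : ℕ → E.proGroup → Prop := fun k g =>
    g ∈ E.expSubgroup ⊤ ∧ E.restrictTo (m k) (g • lam) = E.restrictTo (m k) mu
  have step : ∀ k g, P k g → ∃ g', P (k + 1) g' ∧ g'.1 k = g.1 k := by
    rintro k g ⟨hg, hgk⟩
    obtain ⟨a, ha, hak⟩ := h (m (k + 1))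
    have h1 : E.restrictTo (m k) ((a⁻¹ * g) • lam) = E.restrictTo (m k) lam := by
      rw [mul_smul, E.restrictTo_smul_congr a⁻¹ (hgk.trans (E.restrictTo_eq_of_le (hmm k) hak).symm),
        inv_smul_smul]
    obtain ⟨b, hb, hbl, hbk⟩ := hm₀ k (m k) (hm₀m k) (hkm k) (m (k + 1))
      ((hm₀m k).trans (hmm k)) _ (mul_mem (inv_mem ha) hg) h1
    -- Since `b` fixes `lam` at level `m (k + 1)`, `a * b` carries `lam` to `mu` there; since `b`
    -- agrees with `a⁻¹ * g` at level `k`, the component of `g` is unchanged.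
    refine ⟨a * b, ⟨mul_mem ha hb, ?_⟩, ?_⟩
    · rw [mul_smul, E.restrictTo_smul_congr a hbl, hak]
    · change a.1 k * b.1 k = g.1 k
      rw [hbk]
      change a.1 k * ((a.1 k)⁻¹ * g.1 k) = g.1 k
      rw [mul_inv_cancel_left]
  choose! next hnext hnext_eq using step
  obtain ⟨g₀, hg₀⟩ := h (m 0)
  let s : ℕ → E.proGroup := fun k => Nat.rec g₀ next k
  have hs : ∀ k, P k (s k) := fun k => by
    induction k with
    | zero => exact hg₀
    | succ k ih => exact hnext k _ ih
  have hcompat : ∀ k l, k ≤ l → (s l).1 k = (s k).1 k := fun k l hkl => by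
    induction l, hkl using Nat.le_induction with
    | base => rfl
    | succ l hkl ih =>
      exact (E.proGroup_apply_eq_of_le hkl (hnext_eq l _ (hs l))).trans ih
  -- The diagonal sequence is compatible because the component at level `k` no longer changes after
  -- stage `k`.
  refine ⟨⟨fun k => (s k).1 k, fun k => (s k).2.1 k, fun k l hkl f => ?_⟩,
    E.ext_restrictTo fun k => ?_⟩
  · dsimp only
    rw [← hcompat k l hkl]
    exact (s l).2.2 k l hkl f
  · rw [restrictTo_smul]
    exact (E.restrictTo_smul (s k) lam k).symm.trans (E.restrictTo_eq_of_le (hkm k) (hs k).2)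

theorem orbitIdeal_eq_of_orbit_eq {lam mu : Module.Dual ℂ n}
    (h : MulAction.orbit E.proGroup lam = MulAction.orbit E.proGroup mu) :
    E.orbitIdeal lam = E.orbitIdeal mu := by
  have key : ∀ nu : Module.Dual ℂ n, E.orbitIdeal nu
      = ⨅ x ∈ MulAction.orbit E.proGroup nu, evalIdeal x := fun nu => by
    rw [MulAction.orbit, iInf_range, orbitIdeal]
  rw [key, key, h]

end SocleExhaustion

end SocleLie

end

theorem proposition3p32 {n : Type*} [LieRing n] [LieAlgebra ℂ n]
    (E : SocleLie.SocleExhaustion n) (lam mu : Module.Dual ℂ n) :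
    SocleLie.primitiveIdeal lam = SocleLie.primitiveIdeal mu ↔
      MulAction.orbit E.proGroup lam = MulAction.orbit E.proGroup mu := by
  constructor
  · intro h
    obtain ⟨g, rfl⟩ := E.exists_smul_eq (E.exists_restrictTo_smul_eq h)
    exact (MulAction.orbit_smul g lam).symm
  · intro h
    rw [E.primitiveIdeal_eq_orbitIdeal, E.primitiveIdeal_eq_orbitIdeal,
      E.orbitIdeal_eq_of_orbit_eq h]
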